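/- Let $G$ be a finitely generated group with word length $\ell$ associated with a finite symmetric generating set, let $H\le G$ be a subgroup, and let $X=G/H$ with base point $o=eH$ and projection $\pi:G\to X$. For $f:G\to\mathbb C$ put $\|f\|_{(2,1)}=\bigl(\sum_{x\in X}\bigl(\sum_{gH=x}|f(g)|\bigr)^2\bigr)^{1/2}$, and for $f\in\mathbb CG$ let $\|f\|_h=\sup\{\|f*\varphi\|_{(2,1)}:\varphi\in\mathbb CG,\ \|\varphi\|_{(2,1)}\le 1\}$. Assume that $(G,H)$ has pair rapid decay with constants $C_h,s_1>0$, that is, $\|f\|_h\le C_h\|f(1+\ell)^{s_1}\|_{(2,1)}$ for all $f\in\mathbb CG$. Let $\mu$ be a probability measure on $G$ with finite Shannon entropy and with $\sum_{g}\mu(g)(1+\ell(g))^{\beta}<\infty$ for some $\beta\ge 2s_1$. Let $\nu_n=\mu^{*n}*\delta_{o}=\pi_\#(\mu^{*n})$ be the law at time $n$ of the induced random walk on $X$. For a probability measure $\nu$ on $X$ and $\alpha>1$ let $H(\nu)=-\sum_x\nu(x)\log\nu(x)$ and $H_\alpha(\nu)=\frac1{1-\alpha}\log\sum_x\nu(x)^\alpha$.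 Let $\underline h(X,\mu)$, $\overline h(X,\mu)$ be the $\liminf$ and $\limsup$ of $\frac1nH(\nu_n)$, and let $\underline h_\alpha(X,\mu)$, $\overline h_\alpha(X,\mu)$ be the $\liminf$ and $\limsup$ of $\frac1nH_\alpha(\nu_n)$, as $n\to\infty$. For $q\in(1,2]$ let $r_q(\mu)$ be the spectral radius of the Markov operator $\xi\mapsto\sum_g\mu(g)\,\xi(g^{-1}\,\cdot\,)$ on the complex Banach space $\ell^q(X)$, and let $c(G,H;\mu)=\lim_{p\to\infty}\bigl(-p\log r_{p/(p-1)}(\mu)\bigr)$. Then the limit defining $c(G,H;\mu)$ exists and is finite, and $$\underline h(X,\mu)=\overline h(X,\mu)=c(G,H;\mu).$$ Hence the asymptotic Shannon entropy $h(X,\mu)=\lim_{n\to\infty}\frac1nH(\nu_n)$ exists, is finite and equals $c(G,H;\mu)$. Moreover, $$\lim_{\alpha\downarrow1}\underline h_\alpha(X,\mu)=\lim_{\alpha\downarrow1}\overline h_\alpha(X,\mu)=h(X,\mu).$$ If $\mu$ is finitely supported, then for every $\alpha\in(1,2]$ the limit $h_\alpha(X,\mu)=\lim_{n\to\infty}\frac1nH_\alpha(\nu_n)$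 exists, is finite and satisfies $h_\alpha(X,\mu)=\frac{\alpha}{1-\alpha}\log r_\alpha(\mu)$; in particular $\lim_{\alpha\downarrow1}h_\alpha(X,\mu)=h(X,\mu)$. -/

import Mathlib

open Filter Topology
open scoped ENNReal NNReal

noncomputable section

namespace HomogeneousEntropy

/-- `ℓ_S(g)`: the least `n` such that `g` is a product of `n` elements of `S`. -/
def wordLength {G : Type*} [Group G] (S : Finset G) (g : G) : ℕ :=
  sInf {n | ∃ l : List G, (∀ s ∈ l, s ∈ S) ∧ l.prod = g ∧ l.length = n}

/-- Fiber summation along `π : G → G/H`: `(π_# u)(x) = ∑_{gH = x} u(g)`. -/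
def fiberSum {G : Type*} [Group G] (H : Subgroup G) (u : G → ℝ≥0∞) (x : G ⧸ H) : ℝ≥0∞ :=
  ∑' g : {g : G // (g : G ⧸ H) = x}, u g

/-- The mixed norm `‖f‖_{(2,1)} = ‖π_# |f|‖_{ℓ²(G/H)}`. -/
def mixedNorm {G : Type*} [Group G] (H : Subgroup G) (f : G → ℂ) : ℝ≥0∞ :=
  (∑' x : G ⧸ H, fiberSum H (fun g => ‖f g‖ₑ) x ^ 2) ^ (1 / 2 : ℝ)

/-- `‖f‖_h`: the norm of `φ ↦ f * φ` (convolution on `ℂG`) with respect to `‖·‖_{(2,1)}`. -/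
def hybridNorm {G : Type*} [Group G] (H : Subgroup G) (f : MonoidAlgebra ℂ G) : ℝ≥0∞ :=
  ⨆ (φ : MonoidAlgebra ℂ G) (_ : mixedNorm H φ.coeff ≤ 1), mixedNorm H (f * φ).coeff

/-- Pair rapid decay of `(G, H)` with constants `C > 0` and `s₁ > 0`:
`‖f‖_h ≤ C ‖f (1 + ℓ)^{s₁}‖_{(2,1)}` for every `f ∈ ℂG`. -/
def PairRapidDecay {G : Type*} [Group G] (S : Finset G) (H : Subgroup G) (C s₁ : ℝ) : Prop :=
  0 < C ∧ 0 < s₁ ∧ ∀ f : MonoidAlgebra ℂ G,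
    hybridNorm H f ≤ ENNReal.ofReal C *
      mixedNorm H (fun g => f.coeff g * (((1 + (wordLength S g : ℝ)) ^ s₁ : ℝ) : ℂ))

/-- `∑_g μ(g) (1 + ℓ(g))^β < ∞`. -/
def HasFiniteMoment {G : Type*} [Group G] (S : Finset G) (μ : PMF G) (β : ℝ) : Prop :=
  ∑' g : G, μ g * ENNReal.ofReal ((1 + (wordLength S g : ℝ)) ^ β) < ∞

/-- The convolution power `μ^{*n}`, the law of `s_n ⋯ s_1` with `s_i` i.i.d. of law `μ`. -/
def convPow {G : Type*} [Group G] (μ : PMF G) : ℕ → PMF G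
  | 0 => PMF.pure 1
  | n + 1 => μ.bind fun s => (convPow μ n).map fun z => s * z

/-- `ν_n = μ^{*n} * δ_{eH} = π_#(μ^{*n})`, the law of the random walk on `G/H` at time `n`. -/
def walkLaw {G : Type*} [Group G] (H : Subgroup G) (μ : PMF G) (n : ℕ) : PMF (G ⧸ H) :=
  (convPow μ n).map fun g => (g : G ⧸ H)

/-- Shannon entropy `-∑ ν(x) log ν(x) ∈ [0, ∞]`. -/
def shannonEntropy {X : Type*} (ν : PMF X) : ℝ≥0∞ :=
  ∑' x, ENNReal.ofReal (Real.negMulLog (ν x).toReal)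

/-- Rényi entropy `(1 - α)⁻¹ log ∑ ν(x)^α` of order `α > 1`. -/
def renyiEntropy {X : Type*} (α : ℝ) (ν : PMF X) : EReal :=
  ((1 / (1 - α) : ℝ) : EReal) * ENNReal.log (∑' x, ν x ^ α)

/-- `H(ν_n) / n` -/
def shannonSeq {G : Type*} [Group G] (H : Subgroup G) (μ : PMF G) (n : ℕ) : EReal :=
  (shannonEntropy (walkLaw H μ n) : EReal) / (n : EReal)

/-- `H_α(ν_n) / n` -/
def renyiSeq {G : Type*} [Group G] (H : Subgroup G) (μ : PMF G) (α : ℝ) (n : ℕ) : EReal :=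
  renyiEntropy α (walkLaw H μ n) / (n : EReal)

/-- Lower asymptotic entropy. -/
def lowerEntropy {G : Type*} [Group G] (H : Subgroup G) (μ : PMF G) : EReal :=
  liminf (shannonSeq H μ) atTop

/-- Upper asymptotic entropy. -/
def upperEntropy {G : Type*} [Group G] (H : Subgroup G) (μ : PMF G) : EReal :=
  limsup (shannonSeq H μ) atTop

/-- Lower Rényi entropy rate. -/
def lowerRenyiRate {G : Type*} [Group G] (H : Subgroup G) (μ : PMF G) (α : ℝ) : EReal :=
  liminf (renyiSeq H μ α) atTop

/-- Upper Rényi entropy rate. -/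
def upperRenyiRate {G : Type*} [Group G] (H : Subgroup G) (μ : PMF G) (α : ℝ) : EReal :=
  limsup (renyiSeq H μ α) atTop

/-- The complex Banach space `ℓ^q(X)`. -/
abbrev ellq (X : Type*) (q : ℝ≥0∞) : Type _ := lp (fun _ : X => ℂ) q

theorem memlp_comp_equiv {X : Type*} {q : ℝ≥0∞} (e : X ≃ X) {ξ : X → ℂ}
    (hξ : Memℓp (E := fun _ : X => ℂ) ξ q) : Memℓp (E := fun _ : X => ℂ) (fun x => ξ (e x)) q := by
  rcases q.trichotomy with (rfl | rfl | hq)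
  · rw [memℓp_zero_iff] at hξ ⊢
    exact hξ.preimage e.injective.injOn
  · rw [memℓp_infty_iff] at hξ ⊢
    refine hξ.mono ?_
    rintro _ ⟨x, rfl⟩
    exact ⟨e x, rfl⟩
  · rw [memℓp_gen_iff hq] at hξ ⊢
    exact (e.summable_iff (f := fun x => ‖ξ x‖ ^ q.toReal)).2 hξ

theorem norm_comp_equiv {X : Type*} {q : ℝ≥0∞} [Fact (1 ≤ q)] (e : X ≃ X) (ξ : ellq X q) :
    ‖(⟨fun x => ξ (e x), memlp_comp_equiv e ξ.2⟩ : ellq X q)‖ = ‖ξ‖ := by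
  rcases q.trichotomy with (h | h | hq)
  · exact absurd (Fact.out : (1 : ℝ≥0∞) ≤ q) (by simp [h])
  · subst h
    rw [lp.norm_eq_ciSup, lp.norm_eq_ciSup]
    exact e.surjective.iSup_comp (g := fun x => ‖ξ x‖)
  · rw [lp.norm_eq_tsum_rpow hq, lp.norm_eq_tsum_rpow hq]
    congr 1
    exact e.tsum_eq (fun x => ‖ξ x‖ ^ q.toReal)

/-- The quasi-regular representation on `ℓ^q(G/H)`: `(λ(g) ξ)(x) = ξ(g⁻¹ x)`. -/
def quasiRegular {G : Type*} [Group G] (H : Subgroup G) (q : ℝ≥0∞) [Fact (1 ≤ q)] (g : G) :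
    ellq (G ⧸ H) q →L[ℂ] ellq (G ⧸ H) q :=
  LinearMap.mkContinuous
    { toFun := fun ξ => ⟨fun x => ξ (g⁻¹ • x), memlp_comp_equiv (MulAction.toPerm g⁻¹) ξ.2⟩
      map_add' := fun _ _ => rfl
      map_smul' := fun _ _ => rfl }
    1 (fun ξ => by
      rw [one_mul]
      exact (norm_comp_equiv (MulAction.toPerm g⁻¹) ξ).le)

/-- The Markov operator `λ_{X,q}(μ) = ∑_g μ(g) λ_{X,q}(g)` on `ℓ^q(G/H)`; the series converges
absolutely in operator norm, since each `λ_{X,q}(g)` is an isometry. -/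
def markovOp {G : Type*} [Group G] (H : Subgroup G) (q : ℝ≥0∞) [Fact (1 ≤ q)] (μ : PMF G) :
    ellq (G ⧸ H) q →L[ℂ] ellq (G ⧸ H) q :=
  ∑' g : G, ((μ g).toReal : ℂ) • quasiRegular H q g

open Classical in
/-- `r_q(μ)`, the spectral radius of the Markov operator on `ℓ^q(G/H)`, for real `q ≥ 1`
(the value for `q < 1` is immaterial). -/
def specRad {G : Type*} [Group G] (H : Subgroup G) (μ : PMF G) (q : ℝ) : ℝ≥0∞ :=
  if h : 1 ≤ ENNReal.ofReal q then
    haveI : Fact (1 ≤ ENNReal.ofReal q) := ⟨h⟩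
    spectralRadius ℂ (markovOp H (ENNReal.ofReal q) μ)
  else 0

/-- `-p log r_{p/(p-1)}(μ)` -/
def spectralFun {G : Type*} [Group G] (H : Subgroup G) (μ : PMF G) (p : ℝ) : EReal :=
  ((-p : ℝ) : EReal) * ENNReal.log (specRad H μ (p / (p - 1)))

/-- `c(G,H;μ) = lim_{p → ∞} (-p log r_{p/(p-1)}(μ))`. -/
def spectralEntropy {G : Type*} [Group G] (H : Subgroup G) (μ : PMF G) : EReal :=
  limUnder atTop (spectralFun H μ)

end HomogeneousEntropy

end

noncomputable section

namespace HomogeneousEntropy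

/-!
Rapid decay bounds the `ℓ²` norm of the convolution operator of a kernel `m` on `G/H`. Interpolating
with the trivial `ℓ¹` bound by two Hölder inequalities gives, for `1 < q ≤ 2`,
`‖λ_q(m)‖ ^ q ≤ C ^ (2 (q - 1)) * ∑ g, m g * (1 + ℓ g) ^ (2 s₁ (q - 1)) * (π_# m) (gH) ^ (q - 1)`.
Conversely, applying `λ_q(μ) ^ n` to `δ_o` gives `∑ x, ν_n x ^ q ≤ ‖λ_q(μ) ^ n‖ ^ q`, so that the
spectral rate `q / (1 - q) * log r_q(μ)` is at most the Rényi rate, hence at most the Shannon rate.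
For fixed `n`, letting `q ↓ 1` in the first bound for `μ^{*n}` shows that the limit inferior of the
spectral rate is at least `(H(ν_n) - 2 log C - 2 s₁ E log (1 + ℓ)) / n`, and the moment condition
makes the logarithmic moment `O(log n)`. Thus the spectral rate at `1` and the Shannon rate agree.
For finitely supported `μ` the factor `(1 + ℓ) ^ (2 s₁ (q - 1))` is polynomial in `n`, which
identifies the Rényi rate for each fixed `q`.
-/

/-! ### Nonnegative kernels on `G/H` -/

section Kernels

variable {G : Type*} [Group G] (H : Subgroup G)

/-- The convolution `f * φ` of nonnegative functions on `G`. -/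
def conv (f φ : G → ℝ≥0∞) (g : G) : ℝ≥0∞ :=
  ∑' a, f a * φ (a⁻¹ * g)

/-- The convolution `m * ξ` of a nonnegative function on `G` with one on `G/H`, that is, the
quasi-regular representation extended to nonnegative kernels. -/
def kernelAct (m : G → ℝ≥0∞) (ξ : G ⧸ H → ℝ≥0∞) (x : G ⧸ H) : ℝ≥0∞ :=
  ∑' g, m g * ξ (g⁻¹ • x)

theorem tsum_conv_mul (f φ w : G → ℝ≥0∞) :
    ∑' g, conv f φ g * w g = ∑' a, ∑' b, f a * φ b * w (a * b) := by
  simp only [conv, ← ENNReal.tsum_mul_right]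
  rw [ENNReal.tsum_comm]
  refine tsum_congr fun a => ?_
  rw [← (Equiv.mulLeft a).tsum_eq]
  simp only [Equiv.coe_mulLeft, inv_mul_cancel_left]

theorem tsum_kernelAct_mul (m : G → ℝ≥0∞) (ξ φ : G ⧸ H → ℝ≥0∞) :
    ∑' x, kernelAct H m ξ x * φ x = ∑' g, ∑' x, m g * ξ x * φ (g • x) := by
  simp only [kernelAct, ← ENNReal.tsum_mul_right]
  rw [ENNReal.tsum_comm]
  refine tsum_congr fun g => ?_
  rw [← (MulAction.toPerm g : Equiv.Perm (G ⧸ H)).tsum_eq]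
  simp only [MulAction.toPerm_apply, inv_smul_smul]

theorem tsum_kernelAct (m : G → ℝ≥0∞) (ξ : G ⧸ H → ℝ≥0∞) :
    ∑' x, kernelAct H m ξ x = (∑' g, m g) * ∑' x, ξ x := by
  simpa only [Pi.one_apply, mul_one, ENNReal.tsum_mul_left, ENNReal.tsum_mul_right] using
    tsum_kernelAct_mul H m ξ 1

theorem kernelAct_conv (f φ : G → ℝ≥0∞) (ξ : G ⧸ H → ℝ≥0∞) :
    kernelAct H (conv f φ) ξ = kernelAct H f (kernelAct H φ ξ) := by
  funext x
  simp only [kernelAct, tsum_conv_mul f φ fun g => ξ (g⁻¹ • x), ← ENNReal.tsum_mul_left, mul_assoc,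
    mul_inv_rev, mul_smul]

open Classical in
theorem fiberSum_eq_tsum_ite (u : G → ℝ≥0∞) (x : G ⧸ H) :
    fiberSum H u x = ∑' g : G, if (g : G ⧸ H) = x then u g else 0 :=
  (tsum_subtype {g : G | (g : G ⧸ H) = x} u).trans
    (tsum_congr fun g => by simp only [Set.indicator_apply, Set.mem_ofPred_eq])

theorem tsum_fiberSum_mul (u : G → ℝ≥0∞) (φ : G ⧸ H → ℝ≥0∞) :
    ∑' x, fiberSum H u x * φ x = ∑' g : G, u g * φ g := by
  classical
  simp only [fiberSum_eq_tsum_ite, ← ENNReal.tsum_mul_right]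
  rw [ENNReal.tsum_comm]
  refine tsum_congr fun g => ?_
  rw [tsum_eq_single (g : G ⧸ H) fun x hx => by rw [if_neg hx.symm, zero_mul], if_pos rfl]

theorem tsum_fiberSum (u : G → ℝ≥0∞) : ∑' x, fiberSum H u x = ∑' g, u g := by
  simpa only [Pi.one_apply, mul_one] using tsum_fiberSum_mul H u 1

theorem fiberSum_mul_comp_mk (u : G → ℝ≥0∞) (φ : G ⧸ H → ℝ≥0∞) (x : G ⧸ H) :
    fiberSum H (fun g => u g * φ g) x = fiberSum H u x * φ x := by
  rw [fiberSum, fiberSum, ← ENNReal.tsum_mul_right]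
  exact tsum_congr fun g => by rw [g.2]

theorem fiberSum_mono {u v : G → ℝ≥0∞} (h : u ≤ v) : fiberSum H u ≤ fiberSum H v :=
  fun _ => ENNReal.tsum_le_tsum fun g => h g

theorem le_fiberSum (u : G → ℝ≥0∞) (g : G) : u g ≤ fiberSum H u g :=
  ENNReal.le_tsum (f := fun k : {k : G // (k : G ⧸ H) = (g : G ⧸ H)} => u k) ⟨g, rfl⟩

theorem fiberSum_conv (f φ : G → ℝ≥0∞) :
    fiberSum H (conv f φ) = kernelAct H f (fiberSum H φ) := by
  classical
  funext x
  have hdelta (g : G) : (if (g : G ⧸ H) = x then conv f φ g else 0) =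
      conv f φ g * if (g : G ⧸ H) = x then 1 else 0 := by rw [mul_ite, mul_one, mul_zero]
  rw [fiberSum_eq_tsum_ite, tsum_congr hdelta, tsum_conv_mul]
  refine tsum_congr fun a => ?_
  rw [fiberSum_eq_tsum_ite, ← ENNReal.tsum_mul_left]
  refine tsum_congr fun b => ?_
  have hmem : ((a * b : G) : G ⧸ H) = x ↔ (b : G ⧸ H) = a⁻¹ • x := by
    rw [eq_inv_smul_iff]; rfl
  simp only [hmem, mul_ite, mul_one, mul_zero]

theorem tsum_kernelAct_rpow_le_of_forall_finsupp {H} {f : G → ℝ≥0∞} {ξ : G ⧸ H → ℝ≥0∞}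
    (hf : ∀ g, f g ≠ ∞) (hξ : ∀ x, ξ x ≠ ∞) {q : ℝ} (hq : 0 ≤ q) {K : ℝ≥0∞}
    (h : ∀ (f' : G →₀ ℝ≥0) (ξ' : G ⧸ H →₀ ℝ≥0), (∀ g, f' g ≤ f g) → (∀ x, ξ' x ≤ ξ x) →
      ∑' x, kernelAct H (fun g => f' g) (fun x => ξ' x) x ^ q ≤ K) :
    ∑' x, kernelAct H f ξ x ^ q ≤ K := by
  classical
  rw [ENNReal.tsum_eq_iSup_sum]
  refine iSup_le fun A => ?_
  have hlim : Tendsto (fun B : Finset G => ∑ x ∈ A, (∑ g ∈ B, f g * ξ (g⁻¹ • x)) ^ q) atTop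
      (𝓝 (∑ x ∈ A, kernelAct H f ξ x ^ q)) :=
    tendsto_finsetSum _ fun x _ =>
      (ENNReal.continuous_rpow_const.tendsto _).comp ENNReal.summable.hasSum
  refine le_of_tendsto' hlim fun B => ?_
  let D : Finset (G ⧸ H) := Finset.image₂ (fun g x => g⁻¹ • x) B A
  let f' : G →₀ ℝ≥0 := Finsupp.indicator B fun g _ => (f g).toNNReal
  let ξ' : G ⧸ H →₀ ℝ≥0 := Finsupp.indicator D fun x _ => (ξ x).toNNReal
  have hf' (g : G) : (f' g : ℝ≥0∞) = if g ∈ B then f g else 0 := by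
    simp only [f', Finsupp.indicator_apply, dite_eq_ite]
    split_ifs <;> simp [ENNReal.coe_toNNReal (hf g)]
  have hξ' (x : G ⧸ H) : (ξ' x : ℝ≥0∞) = if x ∈ D then ξ x else 0 := by
    simp only [ξ', Finsupp.indicator_apply, dite_eq_ite]
    split_ifs <;> simp [ENNReal.coe_toNNReal (hξ x)]
  refine le_trans ((Finset.sum_le_sum fun x hx => ENNReal.rpow_le_rpow ?_ hq).trans
    (ENNReal.sum_le_tsum A)) (h f' ξ' (fun g => ?_) fun x => ?_)
  · refine le_trans (Finset.sum_le_sum fun g hg => ?_)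
      (ENNReal.sum_le_tsum (f := fun g => (f' g : ℝ≥0∞) * ξ' (g⁻¹ • x)) B)
    rw [hf', hξ', if_pos hg, if_pos (Finset.mem_image₂_of_mem hg hx)]
  · rw [hf']; split_ifs <;> simp
  · rw [hξ']; split_ifs <;> simp

end Kernels

/-! ### The `ℓ²` bound for nonnegative kernels -/

section RapidDecay

variable {G : Type*} [Group G]

/-- The weight `(1 + ℓ)^s` with values in `ℝ≥0∞`. -/
def lengthWeight (S : Finset G) (s : ℝ) (g : G) : ℝ≥0∞ :=
  ENNReal.ofReal ((1 + (wordLength S g : ℝ)) ^ s)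

theorem lengthWeight_ne_zero (S : Finset G) (s : ℝ) (g : G) : lengthWeight S s g ≠ 0 := by
  rw [lengthWeight, Ne, ENNReal.ofReal_eq_zero, not_le]
  positivity

theorem lengthWeight_ne_top (S : Finset G) (s : ℝ) (g : G) : lengthWeight S s g ≠ ∞ :=
  ENNReal.ofReal_ne_top

variable (H : Subgroup G)

theorem mixedNorm_smul (c : ℂ) (f : G → ℂ) : mixedNorm H (c • f) = ‖c‖ₑ * mixedNorm H f := by
  have h : ∀ x : G ⧸ H, fiberSum H (fun g => ‖(c • f) g‖ₑ) x =
      ‖c‖ₑ * fiberSum H (fun g => ‖f g‖ₑ) x := fun x => by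
    simp only [fiberSum, Pi.smul_apply, smul_eq_mul, enorm_mul, ENNReal.tsum_mul_left]
  simp only [mixedNorm, h, mul_pow, ENNReal.tsum_mul_left]
  rw [ENNReal.mul_rpow_of_nonneg _ _ (by norm_num), ← ENNReal.rpow_natCast, ← ENNReal.rpow_mul]
  norm_num

theorem tsum_sq_le_sq_tsum {X : Type*} (u : X → ℝ≥0∞) : ∑' x, u x ^ 2 ≤ (∑' x, u x) ^ 2 := by
  rw [sq (∑' x, u x), ← ENNReal.tsum_mul_right]
  refine ENNReal.tsum_le_tsum fun x => ?_
  rw [sq]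
  gcongr
  exact ENNReal.le_tsum x

theorem mixedNorm_coeff_ne_top (φ : MonoidAlgebra ℂ G) : mixedNorm H φ.coeff ≠ ∞ := by
  have hsum : ∑' g, ‖φ.coeff g‖ₑ ≠ ∞ := by
    rw [tsum_eq_sum (s := φ.coeff.support)
      fun g hg => by rw [Finsupp.notMem_support_iff.1 hg, enorm_zero]]
    exact ENNReal.sum_ne_top.2 fun g _ => enorm_ne_top
  refine ENNReal.rpow_ne_top_of_nonneg (by norm_num)
    (ne_top_of_le_ne_top (ENNReal.pow_ne_top ?_) (tsum_sq_le_sq_tsum _))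
  rwa [tsum_fiberSum]

theorem mixedNorm_eq_zero {f : G → ℂ} : mixedNorm H f = 0 ↔ f = 0 := by
  refine ⟨fun h => funext fun g => ?_, fun h => by simp [h, mixedNorm, fiberSum]⟩
  rw [mixedNorm, ENNReal.rpow_eq_zero_iff_of_pos (by norm_num), ENNReal.tsum_eq_zero] at h
  have hfib := (pow_eq_zero_iff two_ne_zero).1 (h (g : G ⧸ H))
  have hle := le_fiberSum H (fun g => ‖f g‖ₑ) g
  rwa [hfib, nonpos_iff_eq_zero, enorm_eq_zero] at hle

theorem enorm_ofReal_coe_nnreal (r : ℝ≥0) : ‖((r : ℝ) : ℂ)‖ₑ = r := by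
  rw [← ofReal_norm, Complex.norm_of_nonneg r.coe_nonneg, ENNReal.ofReal_coe_nnreal]

theorem enorm_ofReal_toReal {a : ℝ≥0∞} (ha : a ≠ ∞) : ‖((a.toReal : ℝ) : ℂ)‖ₑ = a := by
  rw [ENNReal.toReal, enorm_ofReal_coe_nnreal, ENNReal.coe_toNNReal ha]

theorem mixedNorm_mul_le (f φ : MonoidAlgebra ℂ G) :
    mixedNorm H (f * φ).coeff ≤ hybridNorm H f * mixedNorm H φ.coeff := by
  have hfin := mixedNorm_coeff_ne_top H φ
  rcases eq_or_ne (mixedNorm H φ.coeff) 0 with h0 | h0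
  · have hφ : φ = 0 := MonoidAlgebra.coeff_injective (Finsupp.coe_eq_zero.1
      ((mixedNorm_eq_zero H).1 h0))
    simp [hφ, (mixedNorm_eq_zero H).2]
  obtain ⟨c, hc⟩ : ∃ c : ℂ, ‖c‖ₑ = (mixedNorm H φ.coeff)⁻¹ :=
    ⟨_, enorm_ofReal_toReal (ENNReal.inv_ne_top.2 h0)⟩
  have hunit : mixedNorm H (c • φ).coeff ≤ 1 := by
    rw [MonoidAlgebra.coeff_smul, Finsupp.coe_smul, mixedNorm_smul, hc,
      ENNReal.inv_mul_cancel h0 hfin]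
  have hle : mixedNorm H (f * c • φ).coeff ≤ hybridNorm H f :=
    le_iSup₂_of_le (f := fun (ψ : MonoidAlgebra ℂ G) (_ : mixedNorm H ψ.coeff ≤ 1) =>
      mixedNorm H (f * ψ).coeff) (c • φ) hunit le_rfl
  rw [mul_smul_comm, MonoidAlgebra.coeff_smul, Finsupp.coe_smul, mixedNorm_smul, hc,
    mul_comm, ← div_eq_mul_inv] at hle
  exact (ENNReal.div_le_iff h0 hfin).1 hle

/-- A finitely supported nonnegative function, as an element of the group algebra. -/
def toGroupAlgebra {M : Type*} (f : M →₀ ℝ≥0) : MonoidAlgebra ℂ M :=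
  MonoidAlgebra.ofCoeff (f.mapRange (fun r : ℝ≥0 => ((r : ℝ) : ℂ)) Complex.ofReal_zero)

theorem coeff_toGroupAlgebra {M : Type*} (f : M →₀ ℝ≥0) (g : M) :
    (toGroupAlgebra f).coeff g = ((f g : ℝ) : ℂ) := rfl

theorem enorm_coeff_toGroupAlgebra {M : Type*} (f : M →₀ ℝ≥0) (g : M) :
    ‖(toGroupAlgebra f).coeff g‖ₑ = f g := by
  rw [coeff_toGroupAlgebra, enorm_ofReal_coe_nnreal]

theorem enorm_coeff_toGroupAlgebra_mul (f φ : G →₀ ℝ≥0) (g : G) :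
    ‖(toGroupAlgebra f * toGroupAlgebra φ).coeff g‖ₑ =
      conv (fun g => f g) (fun g => φ g) g := by
  have hcoeff : (toGroupAlgebra f * toGroupAlgebra φ).coeff g =
      (((∑ a ∈ f.support, f a * φ (a⁻¹ * g) : ℝ≥0) : ℝ) : ℂ) := by
    have hsupp : (toGroupAlgebra f).coeff.support ⊆ f.support :=
      fun a => by simp [coeff_toGroupAlgebra]
    rw [MonoidAlgebra.coeff_mul_apply_left,
      Finsupp.sum_of_support_subset _ hsupp _ (by simp)]
    simp [coeff_toGroupAlgebra]
  rw [hcoeff, enorm_ofReal_coe_nnreal, conv,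
    tsum_eq_sum (s := f.support) fun a ha => by simp [Finsupp.notMem_support_iff.1 ha]]
  simp

theorem fiberSum_mapDomain_out (ξ : G ⧸ H →₀ ℝ≥0) (x : G ⧸ H) :
    fiberSum H (fun g => (ξ.mapDomain Quotient.out g : ℝ≥0)) x = ξ x := by
  classical
  have hout : Function.Injective (Quotient.out : G ⧸ H → G) := Quotient.out_injective
  have hx : ((x.out : G) : G ⧸ H) = x := Quotient.out_eq' x
  rw [fiberSum_eq_tsum_ite, tsum_eq_single x.out, if_pos hx, Finsupp.mapDomain_apply hout]
  intro g hg
  split_ifs with hgx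
  · rw [Finsupp.mapDomain_of_notMem_range, ENNReal.coe_zero]
    rintro ⟨y, rfl⟩
    exact hg (by rw [← hgx]; exact congrArg _ (Quotient.out_eq' y).symm)
  · rfl

variable {H} {S : Finset G} {C s₁ : ℝ}

theorem PairRapidDecay.tsum_kernelAct_finsupp_sq_le (hRD : PairRapidDecay S H C s₁) (f : G →₀ ℝ≥0)
    (ξ : G ⧸ H →₀ ℝ≥0) :
    ∑' x, kernelAct H (fun g => f g) (fun x => ξ x) x ^ 2 ≤ ENNReal.ofReal C ^ 2 *
      (∑' x, fiberSum H (fun g => f g * lengthWeight S s₁ g) x ^ 2) *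
        ∑' x, (ξ x : ℝ≥0∞) ^ 2 := by
  have key := (mixedNorm_mul_le H (toGroupAlgebra f)
    (toGroupAlgebra (ξ.mapDomain Quotient.out))).trans
      (mul_le_mul_left (hRD.2.2 (toGroupAlgebra f)) _)
  have hw (g : G) : ‖(toGroupAlgebra f).coeff g *
      (((1 + (wordLength S g : ℝ)) ^ s₁ : ℝ) : ℂ)‖ₑ = f g * lengthWeight S s₁ g := by
    rw [enorm_mul, enorm_coeff_toGroupAlgebra, lengthWeight, ← ofReal_norm, Complex.norm_real,
      Real.norm_of_nonneg (by positivity)]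
  simp only [mixedNorm, hw, enorm_coeff_toGroupAlgebra, enorm_coeff_toGroupAlgebra_mul,
    fiberSum_conv, fiberSum_mapDomain_out,
    funext (fiberSum_mapDomain_out H ξ)] at key
  have hsq (a : ℝ≥0∞) : (a ^ (1 / 2 : ℝ)) ^ 2 = a := by
    rw [← ENNReal.rpow_natCast, ← ENNReal.rpow_mul]; norm_num
  simpa only [mul_pow, hsq] using pow_le_pow_left₀ zero_le key 2

theorem PairRapidDecay.tsum_kernelAct_sq_le (hRD : PairRapidDecay S H C s₁) {f : G → ℝ≥0∞}
    (hf : ∀ g, f g ≠ ∞) {ξ : G ⧸ H → ℝ≥0∞} (hξ : ∀ x, ξ x ≠ ∞) :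
    ∑' x, kernelAct H f ξ x ^ 2 ≤ ENNReal.ofReal C ^ 2 *
      (∑' x, fiberSum H (fun g => f g * lengthWeight S s₁ g) x ^ 2) * ∑' x, ξ x ^ 2 := by
  simp only [← ENNReal.rpow_two]
  refine tsum_kernelAct_rpow_le_of_forall_finsupp hf hξ zero_le_two fun f' ξ' hf' hξ' => ?_
  simp only [ENNReal.rpow_two]
  refine (hRD.tsum_kernelAct_finsupp_sq_le f' ξ').trans ?_
  gcongr with x x
  · exact fiberSum_mono H (fun g => by simpa using mul_le_mul_left (hf' g) _) x
  · exact hξ' x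

end RapidDecay

/-! ### Interpolation between `ℓ¹` and `ℓ²` -/

section Interpolation

theorem tsum_rpow_mul_rpow_le {X : Type*} (u v : X → ℝ≥0∞) {a b : ℝ} (ha : 0 ≤ a) (hb : 0 ≤ b)
    (hab : a + b = 1) :
    ∑' x, u x ^ a * v x ^ b ≤ (∑' x, u x) ^ a * (∑' x, v x) ^ b := by
  let _ : MeasurableSpace X := ⊤
  have h := ENNReal.lintegral_mul_norm_pow_le (μ := MeasureTheory.Measure.count)
    (f := u) (g := v) measurable_from_top.aemeasurable measurable_from_top.aemeasurable ha hb hab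
  simpa only [MeasureTheory.lintegral_count] using h

theorem mul_rpow_sub_one (t : ℝ≥0∞) {α : ℝ} (hα : 1 ≤ α) : t * t ^ (α - 1) = t ^ α := by
  have h := ENNReal.rpow_add_of_nonneg (x := t) 1 (α - 1) zero_le_one (sub_nonneg.2 hα)
  rw [add_sub_cancel, ENNReal.rpow_one] at h
  exact h.symm

theorem rpow_mul_rpow_self (a : ℝ≥0∞) {s t : ℝ} (hs : 0 ≤ s) (ht : 0 ≤ t) (hst : s + t = 1) :
    a ^ s * a ^ t = a := by
  rw [← ENNReal.rpow_add_of_nonneg _ _ hs ht, hst, ENNReal.rpow_one]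

theorem rpow_rpow_mul_rpow_rpow_eq_one {b : ℝ≥0∞} (h0 : b ≠ 0) (htop : b ≠ ∞) {s t u v : ℝ}
    (h : s * u + t * v = 0) : (b ^ s) ^ u * (b ^ t) ^ v = 1 := by
  rw [← ENNReal.rpow_mul, ← ENNReal.rpow_mul, ← ENNReal.rpow_add _ _ h0 htop, h, ENNReal.rpow_zero]

theorem rpow_ne_top_of_ne {b : ℝ≥0∞} (h0 : b ≠ 0) (htop : b ≠ ∞) (s : ℝ) : b ^ s ≠ ∞ := by
  simp [ENNReal.rpow_eq_top_iff, h0, htop]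

variable {G : Type*} [Group G] (H : Subgroup G) {q : ℝ}

/-- Riesz–Thorin for nonnegative kernels, between the `ℓ¹` norm of `f₀` and the `ℓ²` action of
`f₁`, by two applications of Hölder's inequality. -/
theorem tsum_kernelAct_rpow_mul_rpow_le (hq : 1 ≤ q) (hq2 : q ≤ 2) {θ : ℝ}
    (hθ : θ * q = 2 * (q - 1)) (f₀ f₁ : G → ℝ≥0∞) (ξ : G ⧸ H → ℝ≥0∞) :
    ∑' x, kernelAct H (fun g => f₀ g ^ (1 - θ) * f₁ g ^ θ) ξ x ^ q ≤
      ((∑' g, f₀ g) * ∑' x, ξ x ^ q) ^ (2 - q) *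
        (∑' x, kernelAct H f₁ (fun x => ξ x ^ (q / 2)) x ^ 2) ^ (q - 1) := by
  have hq0 : 0 < q := by linarith
  have hθ0 : 0 ≤ θ := nonneg_of_mul_nonneg_left (by linarith) hq0
  have hθ1 : 0 ≤ 1 - θ := nonneg_of_mul_nonneg_left (b := q) (by linarith) hq0
  have hfactor (g : G) (x : G ⧸ H) : f₀ g ^ (1 - θ) * f₁ g ^ θ * ξ x =
      (f₀ g * ξ x ^ q) ^ (1 - θ) * (f₁ g * ξ x ^ (q / 2)) ^ θ := by
    rw [ENNReal.mul_rpow_of_nonneg _ _ hθ1, ENNReal.mul_rpow_of_nonneg _ _ hθ0, mul_mul_mul_comm,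
      ← ENNReal.rpow_mul, ← ENNReal.rpow_mul, rpow_mul_rpow_self (ξ x) (by positivity)
      (by positivity) (by linear_combination (-1 / 2) * hθ)]
  have hpoint (x : G ⧸ H) : kernelAct H (fun g => f₀ g ^ (1 - θ) * f₁ g ^ θ) ξ x ≤
      kernelAct H f₀ (fun x => ξ x ^ q) x ^ (1 - θ) *
        kernelAct H f₁ (fun x => ξ x ^ (q / 2)) x ^ θ := by
    rw [kernelAct, tsum_congr fun g => hfactor g (g⁻¹ • x)]
    exact tsum_rpow_mul_rpow_le _ _ hθ1 hθ0 (by ring)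
  calc ∑' x, kernelAct H (fun g => f₀ g ^ (1 - θ) * f₁ g ^ θ) ξ x ^ q
      ≤ ∑' x, kernelAct H f₀ (fun x => ξ x ^ q) x ^ (2 - q) *
          (kernelAct H f₁ (fun x => ξ x ^ (q / 2)) x ^ 2) ^ (q - 1) := by
        refine ENNReal.tsum_le_tsum fun x => (ENNReal.rpow_le_rpow (hpoint x) hq0.le).trans_eq ?_
        rw [ENNReal.mul_rpow_of_nonneg _ _ hq0.le, ← ENNReal.rpow_mul, ← ENNReal.rpow_mul,
          ← ENNReal.rpow_two, ← ENNReal.rpow_mul, hθ, sub_mul, hθ]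
        ring_nf
    _ ≤ (∑' x, kernelAct H f₀ (fun x => ξ x ^ q) x) ^ (2 - q) *
          (∑' x, kernelAct H f₁ (fun x => ξ x ^ (q / 2)) x ^ 2) ^ (q - 1) :=
        tsum_rpow_mul_rpow_le _ _ (by linarith) (by linarith) (by ring)
    _ = _ := by rw [tsum_kernelAct]

theorem weighted_rpow_mul_rpow (hq : 1 ≤ q) (hq2 : q ≤ 2) {θ : ℝ} (hθ : θ * q = 2 * (q - 1))
    {u F : ℝ≥0∞} (hF0 : u ≠ 0 → F ≠ 0) (hF : F ≠ ∞) :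
    (u * F ^ (q - 1)) ^ (1 - θ) * (u * F ^ (q / 2 - 1)) ^ θ = u := by
  have hθ0 : 0 ≤ θ := nonneg_of_mul_nonneg_left (by linarith) (by linarith : 0 < q)
  have hθ1 : 0 ≤ 1 - θ := nonneg_of_mul_nonneg_left (b := q) (by linarith) (by linarith)
  rw [ENNReal.mul_rpow_of_nonneg _ _ hθ1, ENNReal.mul_rpow_of_nonneg _ _ hθ0, mul_mul_mul_comm,
    rpow_mul_rpow_self u hθ1 hθ0 (sub_add_cancel 1 θ)]
  rcases eq_or_ne u 0 with rfl | hu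
  · rw [zero_mul]
  · rw [rpow_rpow_mul_rpow_rpow_eq_one (hF0 hu) hF (by linear_combination (-1 / 2) * hθ), mul_one]

theorem tsum_mul_fiberSum_rpow (hq : 1 ≤ q) (u : G → ℝ≥0∞) :
    ∑' g : G, u g * fiberSum H u g ^ (q - 1) = ∑' x, fiberSum H u x ^ q := by
  rw [← tsum_fiberSum_mul H u fun x => fiberSum H u x ^ (q - 1)]
  exact tsum_congr fun x => mul_rpow_sub_one _ hq

theorem fiberSum_mul_rpow_sq (hq : 0 < q) (u : G → ℝ≥0∞) {x : G ⧸ H}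
    (hx : fiberSum H u x ≠ ∞) :
    fiberSum H (fun g => u g * fiberSum H u g ^ (q / 2 - 1)) x ^ 2 = fiberSum H u x ^ q := by
  rw [fiberSum_mul_comp_mk H u fun x => fiberSum H u x ^ (q / 2 - 1)]
  rcases eq_or_ne (fiberSum H u x) 0 with h0 | h0
  · rw [h0, zero_mul, ENNReal.zero_rpow_of_pos hq, zero_pow two_ne_zero]
  · rw [mul_pow, ← ENNReal.rpow_two, ← ENNReal.rpow_two, ← ENNReal.rpow_mul,
      ← ENNReal.rpow_add _ _ h0 hx]
    ring_nf

theorem tsum_fiberSum_rpow_le (hq : 1 ≤ q) (m W : G → ℝ≥0∞) (t : ℝ) :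
    ∑' x, fiberSum H (fun g => m g * W g ^ (t / q)) x ^ q ≤
      ∑' g : G, m g * W g ^ t * fiberSum H m g ^ (q - 1) := by
  have hq0 : 0 < q := by linarith
  have hqi : 0 ≤ 1 - 1 / q := sub_nonneg.2 ((div_le_one hq0).2 hq)
  rw [← tsum_fiberSum_mul H (fun g => m g * W g ^ t) fun x => fiberSum H m x ^ (q - 1)]
  refine ENNReal.tsum_le_tsum fun x => ?_
  have hHolder : fiberSum H (fun g => m g * W g ^ (t / q)) x ≤
      fiberSum H m x ^ (1 - 1 / q) * fiberSum H (fun g => m g * W g ^ t) x ^ (1 / q) := by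
    refine le_trans (le_of_eq (tsum_congr fun g => ?_))
      (tsum_rpow_mul_rpow_le _ _ hqi (by positivity) (by ring))
    rw [ENNReal.mul_rpow_of_nonneg _ _ (by positivity), ← ENNReal.rpow_mul, ← mul_assoc,
      rpow_mul_rpow_self _ hqi (by positivity) (by ring), mul_one_div]
  refine (ENNReal.rpow_le_rpow hHolder hq0.le).trans_eq ?_
  rw [ENNReal.mul_rpow_of_nonneg _ _ hq0.le, ← ENNReal.rpow_mul, ← ENNReal.rpow_mul,
    one_div_mul_cancel hq0.ne', ENNReal.rpow_one, sub_mul, one_div_mul_cancel hq0.ne', one_mul,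
    mul_comm]

variable {H} {S : Finset G} {C s₁ : ℝ}

theorem PairRapidDecay.tsum_kernelAct_normalized_sq_le (hRD : PairRapidDecay S H C s₁)
    (hq : 0 < q) {u : G → ℝ≥0∞} (hu : ∀ x, fiberSum H u x ≠ ∞) {ξ : G ⧸ H → ℝ≥0∞}
    (hξ : ∀ x, ξ x ≠ ∞) :
    ∑' x, kernelAct H (fun g => u g * fiberSum H u g ^ (q / 2 - 1) / lengthWeight S s₁ g)
        (fun x => ξ x ^ (q / 2)) x ^ 2 ≤
      ENNReal.ofReal C ^ 2 * (∑' x, fiberSum H u x ^ q) * ∑' x, ξ x ^ q := by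
  have hfin (g : G) : u g * fiberSum H u g ^ (q / 2 - 1) / lengthWeight S s₁ g ≠ ∞ := by
    rcases eq_or_ne (u g) 0 with h0 | h0
    · simp [h0]
    have hle := le_fiberSum H u g
    exact ENNReal.div_ne_top (ENNReal.mul_ne_top (ne_top_of_le_ne_top (hu g) hle)
      (rpow_ne_top_of_ne ((pos_iff_ne_zero.2 h0).trans_le hle).ne' (hu g) _))
      (lengthWeight_ne_zero S s₁ g)
  have hl2 := hRD.tsum_kernelAct_sq_le hfin (ξ := fun x => ξ x ^ (q / 2))
    fun x => ENNReal.rpow_ne_top_of_nonneg (by positivity) (hξ x)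
  have hξsq (x : G ⧸ H) : (ξ x ^ (q / 2)) ^ 2 = ξ x ^ q := by
    rw [← ENNReal.rpow_two, ← ENNReal.rpow_mul, div_mul_cancel₀ _ two_ne_zero]
  have hcancel (g : G) := ENNReal.div_mul_cancel (a := lengthWeight S s₁ g)
    (b := u g * fiberSum H u g ^ (q / 2 - 1)) (lengthWeight_ne_zero S s₁ g)
    (lengthWeight_ne_top S s₁ g)
  rwa [funext hcancel, tsum_congr fun x => fiberSum_mul_rpow_sq H hq u (hu x),
    tsum_congr hξsq] at hl2

theorem PairRapidDecay.tsum_kernelAct_rpow_le_of_ne_top (hRD : PairRapidDecay S H C s₁)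
    (hq : 1 ≤ q) (hq2 : q ≤ 2) {θ : ℝ} (hθ : θ * q = 2 * (q - 1)) {f : G → ℝ≥0∞}
    (hF : ∀ x, fiberSum H (fun g => f g * lengthWeight S s₁ g ^ θ) x ≠ ∞)
    {ξ : G ⧸ H → ℝ≥0∞} (hξ : ∀ x, ξ x ≠ ∞) :
    ∑' x, kernelAct H f ξ x ^ q ≤ ENNReal.ofReal C ^ (2 * (q - 1)) *
      (∑' x, fiberSum H (fun g => f g * lengthWeight S s₁ g ^ θ) x ^ q) * ∑' x, ξ x ^ q := by
  let W := lengthWeight S s₁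
  let u : G → ℝ≥0∞ := fun g => f g * W g ^ θ
  let F := fiberSum H u
  have hq0 : 0 < q := by linarith
  have hθ0 : 0 ≤ θ := nonneg_of_mul_nonneg_left (by linarith) hq0
  have hWθ0 (g : G) : W g ^ θ ≠ 0 :=
    (ENNReal.rpow_pos (pos_iff_ne_zero.2 (lengthWeight_ne_zero S s₁ g))
      (lengthWeight_ne_top S s₁ g)).ne'
  have hWθ (g : G) : W g ^ θ ≠ ∞ := ENNReal.rpow_ne_top_of_nonneg hθ0 (lengthWeight_ne_top S s₁ g)
  -- The weights are chosen so that `‖f₀‖₁` and `‖f₁ W‖²_{(2,1)}` both equal `∑ F ^ q`.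
  let f₀ : G → ℝ≥0∞ := fun g => u g * F g ^ (q - 1)
  let f₁ : G → ℝ≥0∞ := fun g => u g * F g ^ (q / 2 - 1) / W g
  have hf : (fun g => f₀ g ^ (1 - θ) * f₁ g ^ θ) = f := by
    funext g
    have hFu (hg : u g ≠ 0) : F g ≠ 0 := ((pos_iff_ne_zero.2 hg).trans_le (le_fiberSum H u g)).ne'
    rw [ENNReal.div_rpow_of_nonneg _ _ hθ0, ← mul_div_assoc,
      weighted_rpow_mul_rpow hq hq2 hθ hFu (hF g)]
    exact ENNReal.mul_div_cancel_right (hWθ0 g) (hWθ g)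
  have hRT := (tsum_kernelAct_rpow_mul_rpow_le H hq hq2 hθ f₀ f₁ ξ).trans (mul_le_mul_right
    (ENNReal.rpow_le_rpow (hRD.tsum_kernelAct_normalized_sq_le hq0 hF hξ) (by linarith)) _)
  rw [hf, tsum_mul_fiberSum_rpow H hq u, mul_assoc (ENNReal.ofReal C ^ 2),
    ENNReal.mul_rpow_of_nonneg (ENNReal.ofReal C ^ 2) _ (by linarith), mul_left_comm,
    rpow_mul_rpow_self _ (by linarith) (by linarith) (by ring), ← ENNReal.rpow_two,
    ← ENNReal.rpow_mul, ← mul_assoc] at hRT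
  exact hRT

theorem PairRapidDecay.tsum_kernelAct_rpow_le (hRD : PairRapidDecay S H C s₁) (hq : 1 ≤ q)
    (hq2 : q ≤ 2) (f : G → ℝ≥0∞) {ξ : G ⧸ H → ℝ≥0∞} (hξ : ∀ x, ξ x ≠ ∞) :
    ∑' x, kernelAct H f ξ x ^ q ≤ ENNReal.ofReal C ^ (2 * (q - 1)) *
      (∑' g : G, f g * lengthWeight S s₁ g ^ (2 * (q - 1)) * fiberSum H f g ^ (q - 1)) *
        ∑' x, ξ x ^ q := by
  have hq0 : 0 < q := by linarith
  refine le_trans ?_ (mul_le_mul_left (mul_le_mul_right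
    (tsum_fiberSum_rpow_le H hq f (lengthWeight S s₁) (2 * (q - 1))) _) _)
  rcases eq_or_ne (∑' x, fiberSum H (fun g => f g * lengthWeight S s₁ g ^ (2 * (q - 1) / q)) x ^ q)
    ∞ with htop | hfin
  · rcases eq_or_ne (∑' x, ξ x ^ q) 0 with h0 | h0
    · have hξ0 (x : G ⧸ H) : ξ x = 0 :=
        (ENNReal.rpow_eq_zero_iff_of_pos hq0).1 (ENNReal.tsum_eq_zero.1 h0 x)
      simp [kernelAct, hξ0, hq0]
    · have hC : ENNReal.ofReal C ^ (2 * (q - 1)) ≠ 0 :=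
        (ENNReal.rpow_pos (ENNReal.ofReal_pos.2 hRD.1) ENNReal.ofReal_ne_top).ne'
      rw [htop, ENNReal.mul_top hC, ENNReal.top_mul h0]
      exact le_top
  · exact hRD.tsum_kernelAct_rpow_le_of_ne_top hq hq2 (div_mul_cancel₀ _ hq0.ne')
      (fun x h => ENNReal.ne_top_of_tsum_ne_top hfin x (by rw [h, ENNReal.top_rpow_of_pos hq0])) hξ

end Interpolation

/-! ### Convolution powers and the induced walk -/

section Walk

variable {G : Type*} [Group G] (H : Subgroup G) (μ : PMF G) (n : ℕ)

theorem coe_convPow_succ : ⇑(convPow μ (n + 1)) = conv μ (convPow μ n) := by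
  classical
  funext g
  rw [convPow, PMF.bind_apply]
  refine tsum_congr fun s => ?_
  rw [PMF.map_apply, tsum_eq_single (s⁻¹ * g), if_pos (mul_inv_cancel_left s g).symm]
  rintro z hz
  rw [if_neg]
  rintro rfl
  exact hz (inv_mul_cancel_left s z).symm

theorem kernelAct_convPow_zero (ξ : G ⧸ H → ℝ≥0∞) : kernelAct H (convPow μ 0) ξ = ξ := by
  classical
  funext x
  rw [kernelAct, tsum_eq_single 1 fun g hg => by simp [convPow, PMF.pure_apply, hg]]
  simp [convPow]

theorem walkLaw_eq_map : walkLaw H μ n = PMF.map (fun g : G => (g : G ⧸ H)) (convPow μ n) := by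
  -- In `walkLaw`, `convPow μ n` is coerced monadically to a law on `G ⧸ H` and then mapped by `id`.
  change PMF.map id ((convPow μ n).bind fun a => PMF.pure (a : G ⧸ H)) = _
  rw [PMF.map_id]
  rfl

theorem coe_walkLaw : ⇑(walkLaw H μ n) = fiberSum H (convPow μ n) := by
  classical
  funext x
  rw [walkLaw_eq_map, PMF.map_apply, fiberSum_eq_tsum_ite]
  exact tsum_congr fun g => by simp [eq_comm]

theorem walkLaw_zero : walkLaw H μ 0 = PMF.pure ((1 : G) : G ⧸ H) := by
  rw [walkLaw_eq_map, convPow, PMF.pure_map]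

theorem coe_walkLaw_succ : ⇑(walkLaw H μ (n + 1)) = kernelAct H μ (walkLaw H μ n) := by
  rw [coe_walkLaw, coe_walkLaw, coe_convPow_succ, fiberSum_conv]

theorem pow_le_walkLaw (g : G) : μ g ^ n ≤ walkLaw H μ n ((g ^ n : G) : G ⧸ H) := by
  induction n with
  | zero => simp [walkLaw_zero]
  | succ n ih =>
    have hg : g⁻¹ • ((g ^ (n + 1) : G) : G ⧸ H) = ((g ^ n : G) : G ⧸ H) := by
      rw [inv_smul_eq_iff, pow_succ']; rfl
    calc μ g ^ (n + 1) = μ g * μ g ^ n := pow_succ' _ _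
      _ ≤ μ g * walkLaw H μ n (g⁻¹ • ((g ^ (n + 1) : G) : G ⧸ H)) := by rw [hg]; gcongr
      _ ≤ walkLaw H μ (n + 1) ((g ^ (n + 1) : G) : G ⧸ H) := by
        rw [coe_walkLaw_succ]
        exact ENNReal.le_tsum g

end Walk

/-! ### The Markov operator and its spectral radius -/

section MarkovOp

/-- Evaluation at a point, as a continuous functional on `ℓ^q`. -/
def evalCLM {X : Type*} (q : ℝ≥0∞) [Fact (1 ≤ q)] (x : X) : ellq X q →L[ℂ] ℂ :=
  LinearMap.mkContinuous
    { toFun := fun ξ => ξ x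
      map_add' := fun _ _ => rfl
      map_smul' := fun _ _ => rfl }
    1 (fun ξ => by
      rw [one_mul]
      exact lp.norm_apply_le_norm (zero_lt_one.trans_le Fact.out).ne' ξ x)

theorem enorm_rpow_eq_tsum {X : Type*} {q : ℝ} (hq : 0 < q) (ξ : ellq X (ENNReal.ofReal q))
    [Fact (1 ≤ ENNReal.ofReal q)] : ‖ξ‖ₑ ^ q = ∑' x, ‖ξ x‖ₑ ^ q := by
  have hqr : (ENNReal.ofReal q).toReal = q := ENNReal.toReal_ofReal hq.le
  have h := lp.hasSum_norm (p := ENNReal.ofReal q) (by rwa [hqr]) ξ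
  rw [hqr] at h
  rw [← ofReal_norm, ENNReal.ofReal_rpow_of_nonneg (norm_nonneg _) hq.le, ← h.tsum_eq,
    ENNReal.ofReal_tsum_of_nonneg (fun x => by positivity) h.summable]
  refine tsum_congr fun x => ?_
  rw [← ofReal_norm, ENNReal.ofReal_rpow_of_nonneg (norm_nonneg _) hq.le]

variable {G : Type*} [Group G] (H : Subgroup G) (μ : PMF G)

section FixedExponent

variable (q : ℝ≥0∞) [Fact (1 ≤ q)]

theorem summable_markovOp : Summable fun g => ((μ g).toReal : ℂ) • quasiRegular H q g := by
  refine Summable.of_norm_bounded (ENNReal.summable_toReal μ.tsum_coe_ne_top) fun g => ?_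
  rw [norm_smul, Complex.norm_of_nonneg ENNReal.toReal_nonneg]
  exact mul_le_of_le_one_right ENNReal.toReal_nonneg
    (LinearMap.mkContinuous_norm_le _ zero_le_one _)

theorem hasSum_markovOp_apply (ξ : ellq (G ⧸ H) q) (x : G ⧸ H) :
    HasSum (fun g => ((μ g).toReal : ℂ) * ξ (g⁻¹ • x)) (markovOp H q μ ξ x) :=
  ((summable_markovOp H μ q).hasSum.mapL
    (ContinuousLinearMap.apply ℂ (ellq (G ⧸ H) q) ξ)).mapL (evalCLM q x)

theorem enorm_markovOp_apply_le (ξ : ellq (G ⧸ H) q) (x : G ⧸ H) :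
    ‖markovOp H q μ ξ x‖ₑ ≤ kernelAct H μ (fun x => ‖ξ x‖ₑ) x := by
  rw [← (hasSum_markovOp_apply H μ q ξ x).tsum_eq]
  refine enorm_tsum_le_tsum_enorm.trans_eq (tsum_congr fun g => ?_)
  rw [enorm_mul, enorm_ofReal_toReal (μ.apply_ne_top g)]

theorem enorm_markovOp_pow_apply_le (n : ℕ) (ξ : ellq (G ⧸ H) q) (x : G ⧸ H) :
    ‖(markovOp H q μ ^ n) ξ x‖ₑ ≤ kernelAct H (convPow μ n) (fun x => ‖ξ x‖ₑ) x := by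
  induction n generalizing x with
  | zero => rw [kernelAct_convPow_zero]; simp
  | succ n ih =>
    rw [coe_convPow_succ, kernelAct_conv, pow_succ', mul_apply_eq_comp]
    refine (enorm_markovOp_apply_le H μ q _ x).trans (ENNReal.tsum_le_tsum fun g => ?_)
    gcongr
    exact ih _

open Classical in
theorem markovOp_pow_single (n : ℕ) (x : G ⧸ H) :
    (markovOp H q μ ^ n) (lp.single q ((1 : G) : G ⧸ H) (1 : ℂ)) x =
      (((walkLaw H μ n x).toReal : ℝ) : ℂ) := by
  induction n generalizing x with
  | zero =>
    rw [walkLaw_zero, PMF.pure_apply, pow_zero, one_apply_eq_self, lp.single_apply]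
    by_cases h : x = ((1 : G) : G ⧸ H)
    · subst h; simp
    · simp [h]
  | succ n ih =>
    rw [pow_succ', mul_apply_eq_comp,
      ← (hasSum_markovOp_apply H μ q _ x).tsum_eq, coe_walkLaw_succ, kernelAct,
      ENNReal.tsum_toReal_eq (fun g => ENNReal.mul_ne_top (μ.apply_ne_top g)
        ((walkLaw H μ n).apply_ne_top _)), Complex.ofReal_tsum]
    simp only [ih, ENNReal.toReal_mul, Complex.ofReal_mul]

end FixedExponent

open Classical in
/-- The norm of the `n`-th power of the Markov operator on `ℓ^q(G/H)`, for real `q ≥ 1` (the value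
for `q < 1` is immaterial). -/
def markovPowNorm (q : ℝ) (n : ℕ) : ℝ≥0∞ :=
  if h : 1 ≤ ENNReal.ofReal q then
    haveI : Fact (1 ≤ ENNReal.ofReal q) := ⟨h⟩
    ‖markovOp H (ENNReal.ofReal q) μ ^ n‖ₑ
  else 0

variable {q : ℝ} (hq : 1 ≤ q)
include hq

theorem tsum_walkLaw_rpow_le (n : ℕ) :
    ∑' x, walkLaw H μ n x ^ q ≤ markovPowNorm H μ q n ^ q := by
  classical
  have hq0 : 0 < q := by linarith
  have hq1 : 1 ≤ ENNReal.ofReal q := ENNReal.one_le_ofReal.2 hq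
  have : Fact (1 ≤ ENNReal.ofReal q) := ⟨hq1⟩
  rw [markovPowNorm, dif_pos hq1]
  let T := markovOp H (ENNReal.ofReal q) μ ^ n
  let δ : ellq (G ⧸ H) (ENNReal.ofReal q) := lp.single _ ((1 : G) : G ⧸ H) (1 : ℂ)
  have hδ : ‖δ‖ₑ = 1 := by
    rw [← ofReal_norm, lp.norm_single (ENNReal.ofReal_pos.2 hq0), norm_one, ENNReal.ofReal_one]
  have hTδ : ‖T δ‖ₑ ^ q = ∑' x, walkLaw H μ n x ^ q := by
    rw [enorm_rpow_eq_tsum hq0]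
    refine tsum_congr fun x => ?_
    rw [markovOp_pow_single, enorm_ofReal_toReal ((walkLaw H μ n).apply_ne_top _)]
  have hle : ‖T δ‖ₑ ≤ ‖T‖ₑ := by simpa only [hδ, mul_one] using T.le_opENorm δ
  exact hTδ.symm.trans_le (ENNReal.rpow_le_rpow hle hq0.le)

theorem markovPowNorm_rpow_le (n : ℕ) {K : ℝ≥0∞}
    (hK : ∀ ξ : G ⧸ H → ℝ≥0∞, (∀ x, ξ x ≠ ∞) →
      ∑' x, kernelAct H (convPow μ n) ξ x ^ q ≤ K * ∑' x, ξ x ^ q) :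
    markovPowNorm H μ q n ^ q ≤ K := by
  rcases eq_or_ne K ∞ with rfl | hKtop
  · exact le_top
  have hq0 : 0 < q := by linarith
  have hq1 : 1 ≤ ENNReal.ofReal q := ENNReal.one_le_ofReal.2 hq
  have : Fact (1 ≤ ENNReal.ofReal q) := ⟨hq1⟩
  have hKq : K ^ q⁻¹ ≠ ∞ := ENNReal.rpow_ne_top_of_nonneg (by positivity) hKtop
  rw [markovPowNorm, dif_pos hq1, ← ENNReal.le_rpow_inv_iff hq0, ← ofReal_norm,
    ENNReal.ofReal_le_iff_le_toReal hKq]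
  refine ContinuousLinearMap.opNorm_le_bound _ ENNReal.toReal_nonneg fun ξ => ?_
  let T := markovOp H (ENNReal.ofReal q) μ ^ n
  have hpow : ‖T ξ‖ₑ ^ q ≤ K * ‖ξ‖ₑ ^ q := by
    rw [enorm_rpow_eq_tsum hq0, enorm_rpow_eq_tsum hq0]
    refine le_trans (ENNReal.tsum_le_tsum fun x => ?_) (hK (fun x => ‖ξ x‖ₑ) fun x => enorm_ne_top)
    exact ENNReal.rpow_le_rpow (enorm_markovOp_pow_apply_le H μ _ n ξ x) hq0.le
  have hle : ‖T ξ‖ₑ ≤ K ^ q⁻¹ * ‖ξ‖ₑ := by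
    rwa [← ENNReal.rpow_le_rpow_iff hq0, ENNReal.mul_rpow_of_nonneg _ _ hq0.le,
      ENNReal.rpow_inv_rpow hq0.ne']
  simpa only [ENNReal.toReal_mul, toReal_enorm] using
    ENNReal.toReal_mono (ENNReal.mul_ne_top hKq enorm_ne_top) hle

theorem pow_le_markovPowNorm (g : G) (n : ℕ) : μ g ^ n ≤ markovPowNorm H μ q n := by
  have hq0 : 0 < q := by linarith
  rw [← ENNReal.rpow_le_rpow_iff hq0]
  exact (ENNReal.rpow_le_rpow (pow_le_walkLaw H μ n g) hq0.le).trans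
    ((ENNReal.le_tsum (f := fun x => walkLaw H μ n x ^ q) _).trans (tsum_walkLaw_rpow_le H μ hq n))

theorem markovPowNorm_ne_zero (n : ℕ) : markovPowNorm H μ q n ≠ 0 := by
  obtain ⟨g, hg⟩ := μ.support_nonempty
  exact ((ENNReal.pow_pos ((μ.apply_pos_iff g).2 hg) n).trans_le
    (pow_le_markovPowNorm H μ hq g n)).ne'

omit hq in
theorem markovPowNorm_ne_top (n : ℕ) : markovPowNorm H μ q n ≠ ∞ := by
  rw [markovPowNorm]
  split_ifs
  exacts [enorm_ne_top, ENNReal.zero_ne_top]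

theorem tendsto_markovPowNorm :
    Tendsto (fun n : ℕ => markovPowNorm H μ q n ^ (1 / n : ℝ)) atTop (𝓝 (specRad H μ q)) := by
  have hq1 : 1 ≤ ENNReal.ofReal q := ENNReal.one_le_ofReal.2 hq
  simp only [markovPowNorm, specRad, dif_pos hq1]
  exact spectrum.pow_nnnorm_pow_one_div_tendsto_nhds_spectralRadius _

theorem specRad_le_markovPowNorm {n : ℕ} (hn : n ≠ 0) :
    specRad H μ q ≤ markovPowNorm H μ q n ^ (1 / n : ℝ) := by
  have hq1 : 1 ≤ ENNReal.ofReal q := ENNReal.one_le_ofReal.2 hq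
  have : Fact (1 ≤ ENNReal.ofReal q) := ⟨hq1⟩
  simp only [markovPowNorm, specRad, dif_pos hq1]
  obtain ⟨k, rfl⟩ := Nat.exists_eq_succ_of_ne_zero hn
  have hone : ((‖(1 : ellq (G ⧸ H) (ENNReal.ofReal q) →L[ℂ] ellq (G ⧸ H) (ENNReal.ofReal q))‖₊ :
      ℝ≥0∞)) ^ (1 / (k + 1) : ℝ) ≤ 1 :=
    ENNReal.rpow_le_one (by exact_mod_cast ContinuousLinearMap.norm_id_le) (by positivity)
  refine ((spectrum.spectralRadius_le_pow_nnnorm_pow_one_div ℂ _ k).trans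
    (mul_le_of_le_one_right' hone)).trans_eq ?_
  simp [enorm_eq_nnnorm]

theorem le_specRad (g : G) : μ g ≤ specRad H μ q := by
  refine ge_of_tendsto (tendsto_markovPowNorm H μ hq) ?_
  filter_upwards [eventually_ne_atTop 0] with n hn
  calc μ g = (μ g ^ n) ^ (1 / n : ℝ) := by
        rw [one_div, ENNReal.pow_rpow_inv_natCast hn]
    _ ≤ _ := ENNReal.rpow_le_rpow (pow_le_markovPowNorm H μ hq g n) (by positivity)

theorem specRad_ne_zero : specRad H μ q ≠ 0 := by
  obtain ⟨g, hg⟩ := μ.support_nonempty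
  exact (((μ.apply_pos_iff g).2 hg).trans_le (le_specRad H μ hq g)).ne'

theorem specRad_ne_top : specRad H μ q ≠ ∞ :=
  ne_top_of_le_ne_top (ENNReal.rpow_ne_top_of_nonneg (by positivity) (markovPowNorm_ne_top H μ 1))
    (specRad_le_markovPowNorm H μ hq one_ne_zero)

end MarkovOp

/-! ### Power means and the geometric mean -/

section GeometricMean

theorem log_le_rpow_sub_one_div {y ε : ℝ} (hy : 0 < y) (hε : 0 < ε) :
    Real.log y ≤ (y ^ ε - 1) / ε := by
  rw [le_div_iff₀ hε, mul_comm, ← Real.log_rpow hy]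
  exact Real.log_le_sub_one_of_pos (Real.rpow_pos_of_pos hy ε)

theorem rpow_sub_one_div_mono {y ε η : ℝ} (hy : 0 < y) (hε : 0 < ε) (hεη : ε ≤ η) :
    (y ^ ε - 1) / ε ≤ (y ^ η - 1) / η := by
  have hη : 0 < η := hε.trans_le hεη
  have bernoulli := rpow_one_add_le_one_add_mul_self (s := y ^ η - 1) (p := ε / η)
    (by linarith [Real.rpow_pos_of_pos hy η]) (by positivity) ((div_le_one hη).2 hεη)
  rw [add_sub_cancel, ← Real.rpow_mul hy.le, mul_div_cancel₀ _ hη.ne'] at bernoulli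
  rw [div_le_iff₀ hε, div_mul_eq_mul_div, mul_comm, ← div_mul_eq_mul_div]
  linarith

theorem rpow_le_one_add_rpow {y ε η : ℝ} (hy : 0 ≤ y) (hε : 0 ≤ ε) (hεη : ε ≤ η) :
    y ^ ε ≤ 1 + y ^ η := by
  rcases le_total y 1 with h | h
  · linarith [Real.rpow_le_one hy h hε, Real.rpow_nonneg hy η]
  · linarith [Real.rpow_le_rpow_of_exponent_le h hεη]

theorem tendsto_rpow_sub_one_div {y : ℝ} (hy : 0 < y) :
    Tendsto (fun ε : ℝ => (y ^ ε - 1) / ε) (𝓝[>] 0) (𝓝 (Real.log y)) := by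
  have h := (Real.hasStrictDerivAt_const_rpow hy 0).hasDerivAt.tendsto_slope_zero_right
  simp only [zero_add, Real.rpow_zero, one_mul, smul_eq_mul] at h
  exact h.congr fun t => by rw [div_eq_inv_mul]

theorem toReal_mul_le_toReal_mul {t : ℝ≥0∞} {a b : ℝ} (h : t ≠ 0 → a ≤ b) :
    t.toReal * a ≤ t.toReal * b := by
  rcases eq_or_ne t 0 with rfl | ht
  · simp
  · exact mul_le_mul_of_nonneg_left (h ht) ENNReal.toReal_nonneg

variable {ι : Type*} (p : PMF ι) {Y : ι → ℝ}

theorem summable_toReal_pmf : Summable fun i => (p i).toReal :=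
  ENNReal.summable_toReal p.tsum_coe_ne_top

theorem tsum_toReal_pmf : ∑' i, (p i).toReal = 1 := by
  rw [← ENNReal.tsum_toReal_eq p.apply_ne_top, p.tsum_coe, ENNReal.toReal_one]

theorem toReal_pmf_le_one (i : ι) : (p i).toReal ≤ 1 :=
  ENNReal.toReal_le_of_le_ofReal zero_le_one (by simpa using p.coe_le_one i)

theorem summable_mul_rpow_of_le (hY : ∀ i, 0 ≤ Y i) {ε η : ℝ} (hε : 0 ≤ ε) (hεη : ε ≤ η)
    (h : Summable fun i => (p i).toReal * Y i ^ η) :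
    Summable fun i => (p i).toReal * Y i ^ ε := by
  refine Summable.of_nonneg_of_le
    (fun i => mul_nonneg ENNReal.toReal_nonneg (Real.rpow_nonneg (hY i) ε))
    (fun i => ?_) ((summable_toReal_pmf p).add h)
  rw [← mul_one_add]
  gcongr
  exact rpow_le_one_add_rpow (hY i) hε hεη

variable (hY : ∀ i, p i ≠ 0 → 0 < Y i)
include hY

theorem tsum_mul_pos (h : Summable fun i => (p i).toReal * Y i) :
    0 < ∑' i, (p i).toReal * Y i := by
  obtain ⟨i, hi⟩ := p.support_nonempty
  refine h.tsum_pos (fun j => ?_) i (mul_pos (ENNReal.toReal_pos hi (p.apply_ne_top i)) (hY i hi))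
  simpa using toReal_mul_le_toReal_mul fun hj => (hY j hj).le

theorem tsum_mul_log_le_log_tsum (h : Summable fun i => (p i).toReal * Y i)
    (hlog : Summable fun i => (p i).toReal * Real.log (Y i)) :
    ∑' i, (p i).toReal * Real.log (Y i) ≤ Real.log (∑' i, (p i).toReal * Y i) := by
  set E := ∑' i, (p i).toReal * Y i
  have hE : 0 < E := tsum_mul_pos p hY h
  have tangent_line : ∀ i, (p i).toReal * Real.log (Y i) ≤
      (p i).toReal * Y i * E⁻¹ + (p i).toReal * (Real.log E - 1) := fun i => by
    rw [mul_assoc, ← mul_add]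
    refine toReal_mul_le_toReal_mul fun hi => ?_
    have := Real.log_le_sub_one_of_pos (mul_pos (hY i hi) (inv_pos.2 hE))
    rw [Real.log_mul (hY i hi).ne' (inv_pos.2 hE).ne', Real.log_inv] at this
    linarith
  have hp := (summable_toReal_pmf p).mul_right (Real.log E - 1)
  calc ∑' i, (p i).toReal * Real.log (Y i)
      ≤ ∑' i, ((p i).toReal * Y i * E⁻¹ + (p i).toReal * (Real.log E - 1)) :=
        hlog.tsum_le_tsum tangent_line ((h.mul_right _).add hp)
    _ = E * E⁻¹ + 1 * (Real.log E - 1) := by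
        rw [(h.mul_right _).tsum_add hp, tsum_mul_right, tsum_mul_right, tsum_toReal_pmf]
    _ = Real.log E := by rw [mul_inv_cancel₀ hE.ne']; ring

theorem mul_log_rpow (r : ℝ) (i : ι) :
    (p i).toReal * Real.log (Y i ^ r) = r * ((p i).toReal * Real.log (Y i)) := by
  rcases eq_or_ne (p i) 0 with hi | hi
  · simp [hi]
  · rw [Real.log_rpow (hY i hi)]
    ring

theorem mul_tsum_mul_log_le_log_tsum_rpow (r : ℝ) (h : Summable fun i => (p i).toReal * Y i ^ r)
    (hlog : Summable fun i => (p i).toReal * Real.log (Y i)) :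
    r * ∑' i, (p i).toReal * Real.log (Y i) ≤ Real.log (∑' i, (p i).toReal * Y i ^ r) := by
  have key := mul_log_rpow p hY r
  rw [← tsum_mul_left, ← tsum_congr key]
  exact tsum_mul_log_le_log_tsum p (fun i hi => Real.rpow_pos_of_pos (hY i hi) r) h
    ((hlog.mul_left r).congr fun i => (key i).symm)

theorem log_tsum_rpow_div_le {ε : ℝ} (hε : 0 < ε)
    (h : Summable fun i => (p i).toReal * Y i ^ ε) :
    Real.log (∑' i, (p i).toReal * Y i ^ ε) / ε ≤
      ∑' i, (p i).toReal * ((Y i ^ ε - 1) / ε) := by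
  have hsum : ∑' i, (p i).toReal * ((Y i ^ ε - 1) / ε) =
      (∑' i, (p i).toReal * Y i ^ ε - 1) / ε := by
    simp only [mul_div_assoc', mul_sub_one]
    rw [tsum_div_const, h.tsum_sub (summable_toReal_pmf p), tsum_toReal_pmf]
  rw [hsum]
  gcongr
  exact Real.log_le_sub_one_of_pos
    (tsum_mul_pos p (fun i hi => Real.rpow_pos_of_pos (hY i hi) ε) h)

theorem tendsto_tsum_rpow_sub_one_div {η : ℝ} (hη : 0 < η)
    (h : Summable fun i => (p i).toReal * Y i ^ η)
    (hlog : Summable fun i => (p i).toReal * Real.log (Y i)) :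
    Tendsto (fun ε : ℝ => ∑' i, (p i).toReal * ((Y i ^ ε - 1) / ε)) (𝓝[>] 0)
      (𝓝 (∑' i, (p i).toReal * Real.log (Y i))) := by
  have hupper : Summable fun i => (p i).toReal * ((Y i ^ η - 1) / η) := by
    simpa only [mul_div_assoc', mul_sub_one] using (h.sub (summable_toReal_pmf p)).div_const η
  refine tendsto_tsum_of_dominated_convergence (hlog.abs.add hupper.abs) (fun i => ?_) ?_
  · rcases eq_or_ne (p i) 0 with hi | hi
    · simp [hi]
    · exact (tendsto_rpow_sub_one_div (hY i hi)).const_mul _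
  · filter_upwards [Ioc_mem_nhdsGT hη] with ε ⟨hε, hεη⟩ i
    have lower := toReal_mul_le_toReal_mul fun hi => log_le_rpow_sub_one_div (hY i hi) hε
    have upper := toReal_mul_le_toReal_mul fun hi => rpow_sub_one_div_mono (hY i hi) hε hεη
    refine (abs_le_max_abs_abs lower upper).trans (max_le ?_ ?_)
    · exact le_add_of_nonneg_right (abs_nonneg _)
    · exact le_add_of_nonneg_left (abs_nonneg _)

theorem tendsto_log_tsum_rpow_div (hY0 : ∀ i, 0 ≤ Y i) {η : ℝ} (hη : 0 < η)
    (h : Summable fun i => (p i).toReal * Y i ^ η)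
    (hlog : Summable fun i => (p i).toReal * Real.log (Y i)) :
    Tendsto (fun ε : ℝ => Real.log (∑' i, (p i).toReal * Y i ^ ε) / ε) (𝓝[>] 0)
      (𝓝 (∑' i, (p i).toReal * Real.log (Y i))) := by
  refine tendsto_of_tendsto_of_tendsto_of_le_of_le' tendsto_const_nhds
    (tendsto_tsum_rpow_sub_one_div p hY hη h hlog) ?_ ?_
  all_goals
    filter_upwards [Ioc_mem_nhdsGT hη] with ε ⟨hε, hεη⟩
    have hsum := summable_mul_rpow_of_le p hY0 hε.le hεη h
  · rw [le_div_iff₀' hε]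
    exact mul_tsum_mul_log_le_log_tsum_rpow p hY ε hsum hlog
  · exact log_tsum_rpow_div_le p hY hε hsum

end GeometricMean

/-! ### Shannon and Rényi entropy -/

section Entropy

/-- The information content `-log t` of an event of probability `t`, with the junk value `0` at
`t = 0`. -/
def surprisal (t : ℝ≥0∞) : ℝ≥0∞ := ENNReal.ofReal (-Real.log t.toReal)

theorem surprisal_anti {s t : ℝ≥0∞} (hs : s ≠ 0) (ht : t ≠ ∞) (h : s ≤ t) :
    surprisal t ≤ surprisal s := by
  refine ENNReal.ofReal_le_ofReal (neg_le_neg (Real.log_le_log ?_ (ENNReal.toReal_mono ht h)))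
  exact ENNReal.toReal_pos hs (ne_top_of_le_ne_top ht h)

theorem surprisal_mul_le {s t : ℝ≥0∞} (hs : s ≠ 0) (ht : t ≠ 0) (hs' : s ≠ ∞) (ht' : t ≠ ∞) :
    surprisal (s * t) ≤ surprisal s + surprisal t := by
  rw [surprisal, ENNReal.toReal_mul, Real.log_mul (ENNReal.toReal_pos hs hs').ne'
    (ENNReal.toReal_pos ht ht').ne', neg_add]
  exact ENNReal.ofReal_add_le

theorem toReal_surprisal {t : ℝ≥0∞} (ht : t ≤ 1) :
    (surprisal t).toReal = -Real.log t.toReal := by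
  refine ENNReal.toReal_ofReal (neg_nonneg.2 (Real.log_nonpos ENNReal.toReal_nonneg ?_))
  exact ENNReal.toReal_le_of_le_ofReal zero_le_one (by simpa using ht)

variable {X : Type*} (ν : PMF X)

theorem shannonEntropy_eq_tsum_surprisal : shannonEntropy ν = ∑' x, ν x * surprisal (ν x) := by
  refine tsum_congr fun x => ?_
  rw [surprisal, Real.negMulLog, neg_mul_comm, ENNReal.ofReal_mul ENNReal.toReal_nonneg,
    ENNReal.ofReal_toReal (ν.apply_ne_top x)]

theorem hasSum_toReal_mul_log (h : shannonEntropy ν ≠ ∞) :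
    HasSum (fun x => (ν x).toReal * Real.log (ν x).toReal) (-(shannonEntropy ν).toReal) := by
  rw [shannonEntropy_eq_tsum_surprisal] at h ⊢
  rw [ENNReal.tsum_toReal_eq (ENNReal.ne_top_of_tsum_ne_top h)]
  refine (ENNReal.hasSum_toReal h).neg.congr_fun fun x => ?_
  rw [ENNReal.toReal_mul, toReal_surprisal (ν.coe_le_one x)]
  ring

theorem toReal_mul_rpow_sub_one (t : ℝ≥0∞) {α : ℝ} (hα : 1 ≤ α) :
    t.toReal * t.toReal ^ (α - 1) = (t ^ α).toReal := by
  rw [← mul_rpow_sub_one t hα, ENNReal.toReal_mul, ENNReal.toReal_rpow]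

variable {α : ℝ}

theorem tsum_rpow_ne_top (hα : 1 ≤ α) : ∑' x, ν x ^ α ≠ ∞ :=
  ne_top_of_le_ne_top ν.tsum_coe_ne_top
    (ENNReal.tsum_le_tsum fun x => ENNReal.rpow_le_self_of_le_one (ν.coe_le_one x) hα)

theorem tsum_rpow_ne_zero (hα : 0 ≤ α) : ∑' x, ν x ^ α ≠ 0 := by
  obtain ⟨x, hx⟩ := ν.support_nonempty
  exact ((ENNReal.rpow_pos_of_nonneg ((ν.apply_pos_iff x).2 hx) hα).trans_le
    (ENNReal.le_tsum (f := fun x => ν x ^ α) x)).ne'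

theorem renyiEntropy_eq_coe (hα : 1 ≤ α) :
    renyiEntropy α ν = ((1 / (1 - α) * Real.log (∑' x, ν x ^ α).toReal : ℝ) : EReal) := by
  rw [renyiEntropy, ENNReal.log_pos_real (tsum_rpow_ne_zero ν (by linarith))
    (tsum_rpow_ne_top ν hα), EReal.coe_mul]

theorem renyiEntropy_le_shannonEntropy (hα : 1 < α) :
    renyiEntropy α ν ≤ (shannonEntropy ν : EReal) := by
  rcases eq_or_ne (shannonEntropy ν) ∞ with h | h
  · simp [h]
  have hsum : (∑' x, ν x ^ α).toReal = ∑' x, (ν x).toReal * (ν x).toReal ^ (α - 1) := by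
    rw [ENNReal.tsum_toReal_eq (ENNReal.ne_top_of_tsum_ne_top (tsum_rpow_ne_top ν hα.le))]
    exact tsum_congr fun x => (toReal_mul_rpow_sub_one _ hα.le).symm
  have hlog := hasSum_toReal_mul_log ν h
  have jensen := mul_tsum_mul_log_le_log_tsum_rpow ν
    (fun x hx => ENNReal.toReal_pos hx (ν.apply_ne_top x)) (α - 1)
    ((ENNReal.summable_toReal (tsum_rpow_ne_top ν hα.le)).congr fun x =>
      (toReal_mul_rpow_sub_one _ hα.le).symm) hlog.summable
  rw [hlog.tsum_eq, ← hsum] at jensen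
  rw [renyiEntropy_eq_coe ν hα.le, ← EReal.coe_ennreal_toReal h, EReal.coe_le_coe_iff,
    one_div_mul_eq_div, div_le_iff_of_neg (by linarith)]
  linarith

end Entropy

section WalkEntropy

variable {G : Type*} [Group G] (H : Subgroup G)

theorem tsum_kernelAct_mul_surprisal_le {m : G → ℝ≥0∞} {ξ : G ⧸ H → ℝ≥0∞} (hm : ∀ g, m g ≠ ∞)
    (hξ : ∀ x, ξ x ≠ ∞) (hmξ : ∀ x, kernelAct H m ξ x ≠ ∞) :
    ∑' x, kernelAct H m ξ x * surprisal (kernelAct H m ξ x) ≤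
      (∑' g, m g * surprisal (m g)) * ∑' x, ξ x +
        (∑' g, m g) * ∑' x, ξ x * surprisal (ξ x) := by
  have hstep : ∀ g x, m g * ξ x * surprisal (kernelAct H m ξ (g • x)) ≤
      m g * surprisal (m g) * ξ x + m g * (ξ x * surprisal (ξ x)) := fun g x => by
    rcases eq_or_ne (m g) 0 with hg | hg
    · simp [hg]
    rcases eq_or_ne (ξ x) 0 with hx | hx
    · simp [hx]
    have hle : m g * ξ x ≤ kernelAct H m ξ (g • x) := by
      simpa only [inv_smul_smul, kernelAct] using
        ENNReal.le_tsum (f := fun a => m a * ξ (a⁻¹ • g • x)) g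
    calc m g * ξ x * surprisal (kernelAct H m ξ (g • x))
        ≤ m g * ξ x * (surprisal (m g) + surprisal (ξ x)) := by
          gcongr
          exact (surprisal_anti (mul_ne_zero hg hx) (hmξ _) hle).trans
            (surprisal_mul_le hg hx (hm g) (hξ x))
      _ = _ := by ring
  rw [tsum_kernelAct_mul]
  refine (ENNReal.tsum_le_tsum fun g => ENNReal.tsum_le_tsum fun x => hstep g x).trans_eq ?_
  simp only [ENNReal.tsum_add, ENNReal.tsum_mul_left, ENNReal.tsum_mul_right]

variable (μ : PMF G)

theorem shannonEntropy_walkLaw_le (n : ℕ) :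
    shannonEntropy (walkLaw H μ n) ≤ n * shannonEntropy μ := by
  classical
  induction n with
  | zero =>
    rw [walkLaw_zero, shannonEntropy]
    simp only [PMF.pure_apply, Nat.cast_zero, zero_mul, nonpos_iff_eq_zero, ENNReal.tsum_eq_zero]
    intro x
    split_ifs <;> simp
  | succ n ih =>
    have hstep := tsum_kernelAct_mul_surprisal_le H μ.apply_ne_top (walkLaw H μ n).apply_ne_top
      (by rw [← coe_walkLaw_succ]; exact PMF.apply_ne_top _)
    rw [← coe_walkLaw_succ, PMF.tsum_coe, PMF.tsum_coe, mul_one, one_mul,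
      ← shannonEntropy_eq_tsum_surprisal, ← shannonEntropy_eq_tsum_surprisal,
      ← shannonEntropy_eq_tsum_surprisal] at hstep
    calc shannonEntropy (walkLaw H μ (n + 1))
        ≤ shannonEntropy μ + shannonEntropy (walkLaw H μ n) := hstep
      _ ≤ shannonEntropy μ + n * shannonEntropy μ := by gcongr
      _ = (n + 1 : ℕ) * shannonEntropy μ := by push_cast; ring

variable {μ}

theorem shannonEntropy_walkLaw_ne_top (h : shannonEntropy μ ≠ ∞) (n : ℕ) :
    shannonEntropy (walkLaw H μ n) ≠ ∞ :=
  ne_top_of_le_ne_top (ENNReal.mul_ne_top (ENNReal.natCast_ne_top n) h)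
    (shannonEntropy_walkLaw_le H μ n)

theorem toReal_shannonEntropy_walkLaw_div_le (h : shannonEntropy μ ≠ ∞) (n : ℕ) :
    (shannonEntropy (walkLaw H μ n)).toReal / n ≤ (shannonEntropy μ).toReal := by
  refine div_le_of_le_mul₀ n.cast_nonneg ENNReal.toReal_nonneg ?_
  simpa [mul_comm] using ENNReal.toReal_mono (ENNReal.mul_ne_top (ENNReal.natCast_ne_top n) h)
    (shannonEntropy_walkLaw_le H μ n)

theorem shannonSeq_eq_coe (h : shannonEntropy μ ≠ ∞) (n : ℕ) :
    shannonSeq H μ n = (((shannonEntropy (walkLaw H μ n)).toReal / n : ℝ) : EReal) := by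
  rw [shannonSeq, EReal.coe_div, EReal.coe_ennreal_toReal (shannonEntropy_walkLaw_ne_top H h n)]
  rfl

variable (μ)

theorem renyiSeq_eq_coe {α : ℝ} (hα : 1 ≤ α) (n : ℕ) :
    renyiSeq H μ α n =
      ((1 / (1 - α) * Real.log (∑' x, walkLaw H μ n x ^ α).toReal / n : ℝ) : EReal) := by
  rw [renyiSeq, renyiEntropy_eq_coe _ hα, EReal.coe_div]
  rfl

theorem renyiSeq_le_shannonSeq {α : ℝ} (hα : 1 < α) (n : ℕ) :
    renyiSeq H μ α n ≤ shannonSeq H μ n :=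
  EReal.div_le_div_right_of_nonneg (EReal.coe_nonneg.2 n.cast_nonneg)
    (renyiEntropy_le_shannonEntropy _ hα)

end WalkEntropy

/-! ### Word length and moments of convolution powers -/

section WordLength

variable {G : Type*} [Group G] {S : Finset G}

theorem wordLength_one (S : Finset G) : wordLength S 1 = 0 :=
  Nat.le_zero.1 (Nat.sInf_le ⟨[], by simp⟩)

theorem lengthWeight_one (S : Finset G) (s : ℝ) : lengthWeight S s 1 = 1 := by
  simp [lengthWeight, wordLength_one]

theorem hasFiniteMoment_iff (S : Finset G) (μ : PMF G) (β : ℝ) :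
    HasFiniteMoment S μ β ↔ ∑' g, μ g * lengthWeight S β g ≠ ∞ :=
  lt_top_iff_ne_top

theorem HasFiniteMoment.mono {μ : PMF G} {β γ : ℝ} (h : HasFiniteMoment S μ β) (hγ : γ ≤ β) :
    HasFiniteMoment S μ γ := by
  refine lt_of_le_of_lt (ENNReal.tsum_le_tsum fun g => ?_) h
  gcongr
  linarith [Nat.cast_nonneg (α := ℝ) (wordLength S g)]

theorem HasFiniteMoment.summable {μ : PMF G} {β : ℝ} (h : HasFiniteMoment S μ β) :
    Summable fun g => (μ g).toReal * (1 + wordLength S g : ℝ) ^ β := by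
  refine (ENNReal.summable_toReal h.ne).congr fun g => ?_
  rw [ENNReal.toReal_mul, ENNReal.toReal_ofReal (by positivity)]

theorem HasFiniteMoment.summable_log {μ : PMF G} {β : ℝ} (hβ : 0 < β)
    (h : HasFiniteMoment S μ β) :
    Summable fun g => (μ g).toReal * Real.log (1 + wordLength S g) := by
  have hlog : ∀ g, 0 ≤ Real.log (1 + wordLength S g) := fun g => Real.log_nonneg (by simp)
  refine (h.summable.div_const β).of_nonneg_of_le
    (fun g => mul_nonneg ENNReal.toReal_nonneg (hlog g)) fun g => ?_
  rw [mul_div_assoc]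
  gcongr
  exact Real.log_le_rpow_div (by positivity) hβ

theorem toReal_tsum_mul_lengthWeight (S : Finset G) (μ : PMF G) (β : ℝ) :
    (∑' g, μ g * lengthWeight S β g).toReal =
      ∑' g, (μ g).toReal * (1 + wordLength S g : ℝ) ^ β := by
  rw [ENNReal.tsum_toReal_eq fun g => ENNReal.mul_ne_top (μ.apply_ne_top g)
    (lengthWeight_ne_top S β g)]
  refine tsum_congr fun g => ?_
  rw [ENNReal.toReal_mul, lengthWeight, ENNReal.toReal_ofReal (by positivity)]

theorem tsum_convPow_zero_mul (μ : PMF G) (φ : G → ℝ≥0∞) : ∑' g, convPow μ 0 g * φ g = φ 1 := by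
  classical
  rw [tsum_eq_single 1 fun g hg => by simp [convPow, PMF.pure_apply, hg]]
  simp [convPow]

/-- The mean of `log (1 + ℓ)` under the `n`-th convolution power. -/
def meanLogLength (S : Finset G) (μ : PMF G) (n : ℕ) : ℝ :=
  ∑' g, (convPow μ n g).toReal * Real.log (1 + wordLength S g)

variable (hS : ∀ s ∈ S, s⁻¹ ∈ S) (hgen : Subgroup.closure (S : Set G) = ⊤)
include hS hgen

theorem exists_list_prod_eq (g : G) : ∃ l : List G, (∀ s ∈ l, s ∈ S) ∧ l.prod = g := by
  have hg : g ∈ Subgroup.closure (S : Set G) := hgen ▸ Subgroup.mem_top g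
  rw [← Subgroup.mem_toSubmonoid, Subgroup.closure_toSubmonoid] at hg
  obtain ⟨l, hl, rfl⟩ := Submonoid.exists_list_of_mem_closure hg
  refine ⟨l, fun s hs => (hl s hs).elim id fun h => ?_, rfl⟩
  simpa using hS _ h

theorem exists_list_length_eq_wordLength (g : G) :
    ∃ l : List G, (∀ s ∈ l, s ∈ S) ∧ l.prod = g ∧ l.length = wordLength S g := by
  obtain ⟨l, hl, hprod⟩ := exists_list_prod_eq hS hgen g
  exact Nat.sInf_mem (s := {n | ∃ l : List G, (∀ s ∈ l, s ∈ S) ∧ l.prod = g ∧ l.length = n})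
    ⟨l.length, l, hl, hprod, rfl⟩

theorem wordLength_mul_le (g h : G) :
    wordLength S (g * h) ≤ wordLength S g + wordLength S h := by
  obtain ⟨l, hl, hlprod, hllen⟩ := exists_list_length_eq_wordLength hS hgen g
  obtain ⟨k, hk, hkprod, hklen⟩ := exists_list_length_eq_wordLength hS hgen h
  refine Nat.sInf_le ⟨l ++ k, fun s hs => ?_, by simp [hlprod, hkprod], by simp [hllen, hklen]⟩
  exact (List.mem_append.1 hs).elim (hl s) (hk s)

theorem lengthWeight_mul_le {s : ℝ} (hs : 0 ≤ s) (g h : G) :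
    lengthWeight S s (g * h) ≤ lengthWeight S s g * lengthWeight S s h := by
  rw [lengthWeight, lengthWeight, lengthWeight, ← ENNReal.ofReal_mul (by positivity),
    ← Real.mul_rpow (by positivity) (by positivity)]
  have hsub : (wordLength S (g * h) : ℝ) ≤ wordLength S g + wordLength S h := by
    exact_mod_cast wordLength_mul_le hS hgen g h
  gcongr
  nlinarith [mul_nonneg (Nat.cast_nonneg (α := ℝ) (wordLength S g))
    (Nat.cast_nonneg (α := ℝ) (wordLength S h))]

theorem lengthWeight_mul_le_add {s : ℝ} (hs : 0 ≤ s) (hs1 : s ≤ 1) (g h : G) :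
    lengthWeight S s (g * h) ≤ lengthWeight S s g + lengthWeight S s h := by
  rw [lengthWeight, lengthWeight, lengthWeight,
    ← ENNReal.ofReal_add (by positivity) (by positivity)]
  have hsub : (wordLength S (g * h) : ℝ) ≤ wordLength S g + wordLength S h := by
    exact_mod_cast wordLength_mul_le hS hgen g h
  refine ENNReal.ofReal_le_ofReal (le_trans ?_
    (Real.rpow_add_le_add_rpow (p := s) (by positivity) (by positivity) hs hs1))
  exact Real.rpow_le_rpow (by positivity) (by linarith) hs

variable {μ : PMF G} {γ : ℝ}

theorem HasFiniteMoment.convPow (hγ : 0 ≤ γ) (h : HasFiniteMoment S μ γ) (n : ℕ) :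
    HasFiniteMoment S (convPow μ n) γ := by
  rw [hasFiniteMoment_iff] at h ⊢
  induction n with
  | zero => simp [tsum_convPow_zero_mul, lengthWeight_one]
  | succ n ih =>
    rw [coe_convPow_succ, tsum_conv_mul]
    refine ne_top_of_le_ne_top (ENNReal.mul_ne_top h ih) ?_
    calc ∑' t, ∑' z, μ t * HomogeneousEntropy.convPow μ n z * lengthWeight S γ (t * z)
        ≤ ∑' t, ∑' z, μ t * lengthWeight S γ t *
            (HomogeneousEntropy.convPow μ n z * lengthWeight S γ z) := by
          refine ENNReal.tsum_le_tsum fun t => ENNReal.tsum_le_tsum fun z => ?_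
          rw [mul_mul_mul_comm]
          gcongr
          exact lengthWeight_mul_le hS hgen hγ t z
      _ = _ := by simp only [ENNReal.tsum_mul_left, ENNReal.tsum_mul_right]

theorem tsum_convPow_mul_lengthWeight_le (hγ : 0 ≤ γ) (hγ1 : γ ≤ 1) (n : ℕ) :
    ∑' g, convPow μ n g * lengthWeight S γ g ≤
      1 + n * ∑' g, μ g * lengthWeight S γ g := by
  induction n with
  | zero => simp [tsum_convPow_zero_mul, lengthWeight_one]
  | succ n ih =>
    rw [coe_convPow_succ, tsum_conv_mul]
    calc ∑' t, ∑' z, μ t * convPow μ n z * lengthWeight S γ (t * z)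
        ≤ ∑' t, ∑' z, (μ t * lengthWeight S γ t * convPow μ n z +
            μ t * (convPow μ n z * lengthWeight S γ z)) := by
          refine ENNReal.tsum_le_tsum fun t => ENNReal.tsum_le_tsum fun z => ?_
          refine (mul_le_mul_right (lengthWeight_mul_le_add hS hgen hγ hγ1 t z) _).trans_eq ?_
          ring
      _ = ∑' g, μ g * lengthWeight S γ g + ∑' g, convPow μ n g * lengthWeight S γ g := by
          simp only [ENNReal.tsum_add, ENNReal.tsum_mul_left, ENNReal.tsum_mul_right,
            PMF.tsum_coe, mul_one, one_mul]
      _ ≤ ∑' g, μ g * lengthWeight S γ g + (1 + n * ∑' g, μ g * lengthWeight S γ g) := by gcongr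
      _ = 1 + (n + 1 : ℕ) * ∑' g, μ g * lengthWeight S γ g := by push_cast; ring

theorem meanLogLength_le (hγ : 0 < γ) (hγ1 : γ ≤ 1) (h : HasFiniteMoment S μ γ) (n : ℕ) :
    meanLogLength S μ n ≤
      γ⁻¹ * Real.log (1 + n * (∑' g, μ g * lengthWeight S γ g).toReal) := by
  have hn := h.convPow hS hgen hγ.le n
  have hpos : ∀ g : G, 0 < (1 + wordLength S g : ℝ) := fun g => by positivity
  have hfin : (n : ℝ≥0∞) * ∑' g, μ g * lengthWeight S γ g ≠ ∞ :=
    ENNReal.mul_ne_top (ENNReal.natCast_ne_top n) ((hasFiniteMoment_iff S μ γ).1 h)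
  have moment_le : ∑' g, (convPow μ n g).toReal * (1 + wordLength S g : ℝ) ^ γ ≤
      1 + n * (∑' g, μ g * lengthWeight S γ g).toReal := by
    rw [← toReal_tsum_mul_lengthWeight]
    simpa [ENNReal.toReal_add ENNReal.one_ne_top hfin] using
      ENNReal.toReal_mono (ENNReal.add_ne_top.2 ⟨ENNReal.one_ne_top, hfin⟩)
        (tsum_convPow_mul_lengthWeight_le hS hgen hγ.le hγ1 n)
  rw [← div_eq_inv_mul, le_div_iff₀' hγ]
  calc γ * meanLogLength S μ n
      ≤ Real.log (∑' g, (convPow μ n g).toReal * (1 + wordLength S g : ℝ) ^ γ) :=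
        mul_tsum_mul_log_le_log_tsum_rpow (convPow μ n) (fun g _ => hpos g) γ hn.summable
          (hn.summable_log hγ)
    _ ≤ _ := Real.log_le_log (tsum_mul_pos (convPow μ n)
        (fun g _ => Real.rpow_pos_of_pos (hpos g) γ) hn.summable) moment_le

end WordLength

theorem tendsto_log_one_add_mul_div {M : ℝ} (hM : 0 ≤ M) :
    Tendsto (fun n : ℕ => Real.log (1 + n * M) / n) atTop (𝓝 0) := by
  have hlog : Tendsto (fun n : ℕ => Real.log n / n) atTop (𝓝 0) := by
    simpa [Function.comp_def] using (Real.tendsto_pow_log_div_mul_add_atTop 1 0 1 one_ne_zero).comp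
      (tendsto_natCast_atTop_atTop (R := ℝ))
  have hsum := (tendsto_const_div_atTop_nhds_zero_nat (Real.log (1 + M))).add hlog
  rw [add_zero] at hsum
  refine squeeze_zero' (Eventually.of_forall fun n => ?_) ?_ hsum
  · exact div_nonneg (Real.log_nonneg (le_add_of_nonneg_right (by positivity))) n.cast_nonneg
  · filter_upwards [eventually_ge_atTop 1] with n hn
    have hn' : (1 : ℝ) ≤ n := by exact_mod_cast hn
    rw [← add_div, ← Real.log_mul (by positivity) (by positivity)]
    gcongr
    nlinarith

/-! ### The spectral rate -/

section SpectralRate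

variable {G : Type*} [Group G] (H : Subgroup G) (μ : PMF G)

/-- The number `q / (1 - q) * log r_q(μ)`. For `q = p / (p - 1)` the prefactor is `-p`, so the limit
defining the spectral entropy is the limit of the spectral rate as `q ↓ 1`. -/
def spectralRate (q : ℝ) : ℝ :=
  q / (1 - q) * Real.log (specRad H μ q).toReal

/-- The quantity `q / (1 - q) * log ‖λ_q(μ)^n‖ / n`, which tends to the spectral rate by Gelfand's
formula. -/
def spectralRateSeq (q : ℝ) (n : ℕ) : ℝ :=
  q / (1 - q) * (Real.log (markovPowNorm H μ q n).toReal / n)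

theorem coe_spectralRate {q : ℝ} (hq : 1 ≤ q) :
    (spectralRate H μ q : EReal) = ((q / (1 - q) : ℝ) : EReal) * ENNReal.log (specRad H μ q) := by
  rw [spectralRate, ENNReal.log_pos_real (specRad_ne_zero H μ hq) (specRad_ne_top H μ hq),
    EReal.coe_mul]

theorem spectralFun_eq_coe {p : ℝ} (hp : 1 < p) :
    spectralFun H μ p = (spectralRate H μ (p / (p - 1)) : EReal) := by
  have hp1 : 0 < p - 1 := sub_pos.2 hp
  have conjugate : p / (p - 1) / (1 - p / (p - 1)) = -p := by
    rw [one_sub_div hp1.ne', sub_sub_cancel_left, div_div_div_cancel_right₀ hp1.ne', div_neg,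
      div_one]
  rw [spectralFun, coe_spectralRate H μ ((one_le_div hp1).2 (by linarith)), conjugate]

theorem toReal_markovPowNorm_pos {q : ℝ} (hq : 1 ≤ q) (n : ℕ) :
    0 < (markovPowNorm H μ q n).toReal :=
  ENNReal.toReal_pos (markovPowNorm_ne_zero H μ hq n) (markovPowNorm_ne_top H μ n)

theorem log_toReal_markovPowNorm_rpow {q : ℝ} (hq : 1 ≤ q) (n : ℕ) :
    Real.log (markovPowNorm H μ q n ^ (1 / n : ℝ)).toReal =
      Real.log (markovPowNorm H μ q n).toReal / n := by
  rw [← ENNReal.toReal_rpow, Real.log_rpow (toReal_markovPowNorm_pos H μ hq n), one_div_mul_eq_div]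

theorem tendsto_spectralRateSeq {q : ℝ} (hq : 1 ≤ q) :
    Tendsto (spectralRateSeq H μ q) atTop (𝓝 (spectralRate H μ q)) := by
  have hpos := ENNReal.toReal_pos (specRad_ne_zero H μ hq) (specRad_ne_top H μ hq)
  have gelfand := (ENNReal.tendsto_toReal (specRad_ne_top H μ hq)).comp
    (tendsto_markovPowNorm H μ hq)
  refine ((gelfand.log hpos.ne').congr fun n => ?_).const_mul _
  exact log_toReal_markovPowNorm_rpow H μ hq n

theorem spectralRateSeq_le_spectralRate {q : ℝ} (hq : 1 < q) {n : ℕ} (hn : n ≠ 0) :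
    spectralRateSeq H μ q n ≤ spectralRate H μ q := by
  refine mul_le_mul_of_nonpos_left ?_ (div_nonpos_of_nonneg_of_nonpos (by linarith) (by linarith))
  rw [← log_toReal_markovPowNorm_rpow H μ hq.le]
  refine Real.log_le_log
    (ENNReal.toReal_pos (specRad_ne_zero H μ hq.le) (specRad_ne_top H μ hq.le)) ?_
  exact ENNReal.toReal_mono (ENNReal.rpow_ne_top_of_nonneg (by positivity)
    (markovPowNorm_ne_top H μ n)) (specRad_le_markovPowNorm H μ hq.le hn)

theorem spectralRateSeq_le_renyiSeq {q : ℝ} (hq : 1 < q) (n : ℕ) :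
    (spectralRateSeq H μ q n : EReal) ≤ renyiSeq H μ q n := by
  have hq0 : 0 < q := by linarith
  have hlog : Real.log (∑' x, walkLaw H μ n x ^ q).toReal ≤
      q * Real.log (markovPowNorm H μ q n).toReal := by
    rw [← Real.log_rpow (toReal_markovPowNorm_pos H μ hq.le n), ENNReal.toReal_rpow]
    exact Real.log_le_log
      (ENNReal.toReal_pos (tsum_rpow_ne_zero _ hq0.le) (tsum_rpow_ne_top _ hq.le))
      (ENNReal.toReal_mono (ENNReal.rpow_ne_top_of_nonneg hq0.le (markovPowNorm_ne_top H μ n))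
        (tsum_walkLaw_rpow_le H μ hq.le n))
  rw [renyiSeq_eq_coe H μ hq.le, EReal.coe_le_coe_iff]
  calc spectralRateSeq H μ q n
      = 1 / (1 - q) * (q * Real.log (markovPowNorm H μ q n).toReal) / n := by
        rw [spectralRateSeq]; ring
    _ ≤ _ := by
      gcongr ?_ / _
      exact mul_le_mul_of_nonpos_left hlog (one_div_nonpos.2 (by linarith))

theorem spectralRate_le_lowerRenyiRate {q : ℝ} (hq : 1 < q) :
    (spectralRate H μ q : EReal) ≤ lowerRenyiRate H μ q := by
  rw [← ((continuous_coe_real_ereal.tendsto _).comp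
    (tendsto_spectralRateSeq H μ hq.le)).liminf_eq]
  exact liminf_le_liminf (Eventually.of_forall (spectralRateSeq_le_renyiSeq H μ hq))

theorem tendsto_div_sub_one_atTop :
    Tendsto (fun p : ℝ => p / (p - 1)) atTop (𝓝[>] 1) := by
  have hinv : Tendsto (fun p : ℝ => 1 + (p - 1)⁻¹) atTop (𝓝 (1 + 0)) :=
    (tendsto_inv_atTop_zero.comp (tendsto_atTop_add_const_right _ (-1) tendsto_id)).const_add 1
  rw [add_zero] at hinv
  refine tendsto_nhdsWithin_iff.2 ⟨hinv.congr' ?_, ?_⟩ <;>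
    filter_upwards [eventually_gt_atTop 1] with p hp
  · rw [inv_eq_one_div, one_add_div (sub_pos.2 hp).ne', sub_add_cancel]
  · exact (one_lt_div (sub_pos.2 hp)).2 (sub_one_lt p)

theorem tendsto_spectralFun {h : ℝ} (hrate : Tendsto (spectralRate H μ) (𝓝[>] 1) (𝓝 h)) :
    Tendsto (spectralFun H μ) atTop (𝓝 (h : EReal)) := by
  refine ((continuous_coe_real_ereal.tendsto h).comp
    (hrate.comp tendsto_div_sub_one_atTop)).congr' ?_
  filter_upwards [eventually_gt_atTop 1] with p hp
  exact (spectralFun_eq_coe H μ hp).symm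

end SpectralRate

/-! ### Lower bounds for the spectral rate -/

section LowerBound

variable {G : Type*} [Group G] {S : Finset G} {H : Subgroup G} {C s₁ : ℝ}

theorem PairRapidDecay.le_spectralRateSeq (hRD : PairRapidDecay S H C s₁) (μ : PMF G) {q : ℝ}
    (hq : 1 < q) (hq2 : q ≤ 2) (n : ℕ) {K : ℝ} (hK0 : 0 < K)
    (hK : ∑' g : G, convPow μ n g * lengthWeight S s₁ g ^ (2 * (q - 1)) *
        walkLaw H μ n g ^ (q - 1) ≤ ENNReal.ofReal K) :
    -(2 * Real.log C + Real.log K / (q - 1)) / n ≤ spectralRateSeq H μ q n := by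
  have hq0 : 0 < q - 1 := sub_pos.2 hq
  have hC := hRD.1
  have norm_le : markovPowNorm H μ q n ^ q ≤ ENNReal.ofReal (C ^ (2 * (q - 1)) * K) := by
    refine markovPowNorm_rpow_le H μ hq.le n fun ξ hξ =>
      (hRD.tsum_kernelAct_rpow_le hq.le hq2 (convPow μ n) hξ).trans ?_
    rw [ENNReal.ofReal_mul (by positivity), ← ENNReal.ofReal_rpow_of_pos hC, ← coe_walkLaw]
    gcongr
  have log_le : q * Real.log (markovPowNorm H μ q n).toReal ≤
      2 * (q - 1) * Real.log C + Real.log K := by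
    have hN := toReal_markovPowNorm_pos H μ hq.le n
    rw [← Real.log_rpow hN, ← Real.log_rpow hC, ← Real.log_mul (by positivity) hK0.ne']
    refine Real.log_le_log (by positivity) ?_
    rw [ENNReal.toReal_rpow]
    exact ENNReal.toReal_le_of_le_ofReal (by positivity) norm_le
  calc -(2 * Real.log C + Real.log K / (q - 1)) / n
      = -((2 * (q - 1) * Real.log C + Real.log K) / (q - 1)) / n := by field_simp
    _ ≤ -(q * Real.log (markovPowNorm H μ q n).toReal / (q - 1)) / n := by gcongr
    _ = spectralRateSeq H μ q n := by
      rw [spectralRateSeq, ← neg_sub q 1, div_neg]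
      ring

theorem hasSum_convPow_mul_log_walkLaw (H : Subgroup G) (μ : PMF G) (n : ℕ)
    (h : shannonEntropy (walkLaw H μ n) ≠ ∞) :
    HasSum (fun g : G => (convPow μ n g).toReal * Real.log (walkLaw H μ n g).toReal)
      (-(shannonEntropy (walkLaw H μ n)).toReal) := by
  have hsum : ∑' g : G, convPow μ n g * surprisal (walkLaw H μ n g) =
      shannonEntropy (walkLaw H μ n) := by
    rw [shannonEntropy_eq_tsum_surprisal, coe_walkLaw]
    exact (tsum_fiberSum_mul H (convPow μ n) fun x => surprisal (fiberSum H (convPow μ n) x)).symm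
  rw [← hsum] at h ⊢
  rw [ENNReal.tsum_toReal_eq (ENNReal.ne_top_of_tsum_ne_top h)]
  refine (ENNReal.hasSum_toReal h).neg.congr_fun fun g => ?_
  rw [ENNReal.toReal_mul, toReal_surprisal ((walkLaw H μ n).coe_le_one _), mul_neg, neg_neg]

theorem walkLaw_ne_zero (H : Subgroup G) {μ : PMF G} {n : ℕ} {g : G} (hg : convPow μ n g ≠ 0) :
    walkLaw H μ n g ≠ 0 := by
  rw [coe_walkLaw]
  exact ne_bot_of_le_ne_bot hg (le_fiberSum H _ g)

/-- The weight `ν_n(gH) * (1 + ℓ(g))^{2s}`. Its moment of order `q - 1` under `μ^{*n}` controls the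
norm of `λ_q(μ)^n`, and the derivative of that moment at `q = 1` is its logarithmic moment. -/
def interpolationWeight (S : Finset G) (H : Subgroup G) (μ : PMF G) (s : ℝ) (n : ℕ) (g : G) : ℝ :=
  (walkLaw H μ n g).toReal * (1 + wordLength S g : ℝ) ^ (2 * s)

variable (S H) (s : ℝ)

theorem interpolationWeight_nonneg (μ : PMF G) (n : ℕ) (g : G) :
    0 ≤ interpolationWeight S H μ s n g := by
  rw [interpolationWeight]
  positivity

theorem interpolationWeight_pos {μ : PMF G} {n : ℕ} {g : G} (hg : convPow μ n g ≠ 0) :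
    0 < interpolationWeight S H μ s n g :=
  mul_pos (ENNReal.toReal_pos (walkLaw_ne_zero H hg) ((walkLaw H μ n).apply_ne_top _))
    (by positivity)

theorem ofReal_interpolationWeight_rpow (μ : PMF G) (n : ℕ) (g : G) {ε : ℝ} (hε : 0 ≤ ε) :
    ENNReal.ofReal (interpolationWeight S H μ s n g ^ ε) =
      lengthWeight S s g ^ (2 * ε) * walkLaw H μ n g ^ ε := by
  rw [interpolationWeight, ← ENNReal.ofReal_rpow_of_nonneg (by positivity) hε,
    ENNReal.ofReal_mul ENNReal.toReal_nonneg,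
    ENNReal.ofReal_toReal ((walkLaw H μ n).apply_ne_top _),
    ENNReal.mul_rpow_of_nonneg _ _ hε, mul_comm, lengthWeight,
    ← ENNReal.ofReal_rpow_of_pos (by positivity), ← ENNReal.ofReal_rpow_of_pos (by positivity),
    ← ENNReal.rpow_mul, ← ENNReal.rpow_mul]
  congr 2
  ring

variable {s}

theorem summable_interpolationWeight_rpow (μ : PMF G) (n : ℕ) {η : ℝ} (hη : 0 ≤ η)
    (h : HasFiniteMoment S (convPow μ n) (2 * s * η)) :
    Summable fun g => (convPow μ n g).toReal * interpolationWeight S H μ s n g ^ η := by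
  refine h.summable.of_nonneg_of_le (fun g => mul_nonneg ENNReal.toReal_nonneg
    (Real.rpow_nonneg (interpolationWeight_nonneg S H s μ n g) η)) fun g => ?_
  rw [interpolationWeight, Real.mul_rpow ENNReal.toReal_nonneg (by positivity),
    ← Real.rpow_mul (by positivity)]
  gcongr
  exact mul_le_of_le_one_left (by positivity)
    (Real.rpow_le_one ENNReal.toReal_nonneg (toReal_pmf_le_one _ _) hη)

theorem hasSum_log_interpolationWeight {μ : PMF G} {n : ℕ}
    (hent : shannonEntropy (walkLaw H μ n) ≠ ∞) {β : ℝ} (hβ : 0 < β)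
    (h : HasFiniteMoment S (convPow μ n) β) :
    HasSum (fun g => (convPow μ n g).toReal * Real.log (interpolationWeight S H μ s n g))
      (-(shannonEntropy (walkLaw H μ n)).toReal + 2 * s * meanLogLength S μ n) := by
  refine ((hasSum_convPow_mul_log_walkLaw H μ n hent).add
    ((h.summable_log hβ).hasSum.mul_left (2 * s))).congr_fun fun g => ?_
  rcases eq_or_ne (convPow μ n g) 0 with hg | hg
  · simp [hg]
  · rw [interpolationWeight, Real.log_mul (ENNReal.toReal_ne_zero.2
      ⟨walkLaw_ne_zero H hg, (walkLaw H μ n).apply_ne_top _⟩) (by positivity),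
      Real.log_rpow (by positivity)]
    ring

variable {S H}

theorem PairRapidDecay.le_spectralRateSeq_of_moment (hRD : PairRapidDecay S H C s₁) {μ : PMF G}
    {q : ℝ} (hq : 1 < q) (hq2 : q ≤ 2) {n : ℕ}
    (hmom : HasFiniteMoment S (convPow μ n) (2 * s₁ * (q - 1))) :
    -(2 * Real.log C + Real.log (∑' g, (convPow μ n g).toReal *
        interpolationWeight S H μ s₁ n g ^ (q - 1)) / (q - 1)) / n ≤ spectralRateSeq H μ q n := by
  have hq0 : 0 ≤ q - 1 := sub_nonneg.2 hq.le
  have hsum := summable_interpolationWeight_rpow S H μ n hq0 hmom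
  have hpos := tsum_mul_pos (convPow μ n)
    (fun g hg => Real.rpow_pos_of_pos (interpolationWeight_pos S H s₁ hg) (q - 1)) hsum
  refine hRD.le_spectralRateSeq μ hq hq2 n hpos (le_of_eq ?_)
  rw [ENNReal.ofReal_tsum_of_nonneg (fun g => mul_nonneg ENNReal.toReal_nonneg
    (Real.rpow_nonneg (interpolationWeight_nonneg S H s₁ μ n g) _)) hsum]
  refine tsum_congr fun g => ?_
  rw [ENNReal.ofReal_mul ENNReal.toReal_nonneg,
    ENNReal.ofReal_toReal ((convPow μ n).apply_ne_top g),
    ofReal_interpolationWeight_rpow S H s₁ μ n g hq0, mul_assoc]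

theorem tendsto_sub_one_nhdsGT_one : Tendsto (fun q : ℝ => q - 1) (𝓝[>] 1) (𝓝[>] 0) := by
  refine tendsto_nhdsWithin_iff.2 ⟨?_, eventually_mem_nhdsWithin.mono fun q hq =>
    Set.mem_Ioi.2 (sub_pos.2 hq)⟩
  exact ((continuous_sub_right (1 : ℝ)).tendsto' 1 0 (sub_self 1)).mono_left nhdsWithin_le_nhds

theorem PairRapidDecay.le_liminf_spectralRate (hRD : PairRapidDecay S H C s₁) {μ : PMF G} {n : ℕ}
    (hn : n ≠ 0) (hent : shannonEntropy (walkLaw H μ n) ≠ ∞) {β : ℝ} (hβ : 0 < β)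
    (hmom : HasFiniteMoment S (convPow μ n) β) :
    ((((shannonEntropy (walkLaw H μ n)).toReal -
      (2 * Real.log C + 2 * s₁ * meanLogLength S μ n)) / n : ℝ) : EReal) ≤
        liminf (fun q => (spectralRate H μ q : EReal)) (𝓝[>] 1) := by
  have hs := hRD.2.1
  let η := β / (2 * s₁)
  have hη : 0 < η := by positivity
  have hηβ : 2 * s₁ * η = β := mul_div_cancel₀ β (by positivity)
  have hlog := hasSum_log_interpolationWeight S H (s := s₁) hent hβ hmom
  have powerMean := tendsto_log_tsum_rpow_div (convPow μ n)
    (fun g hg => interpolationWeight_pos S H s₁ hg) (interpolationWeight_nonneg S H s₁ μ n) hη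
    (summable_interpolationWeight_rpow S H μ n hη.le (hηβ ▸ hmom)) hlog.summable
  have lower := ((powerMean.comp tendsto_sub_one_nhdsGT_one).const_add
    (2 * Real.log C)).neg.div_const (n : ℝ)
  have hlim : (shannonEntropy (walkLaw H μ n)).toReal -
      (2 * Real.log C + 2 * s₁ * meanLogLength S μ n) = -(2 * Real.log C +
        ∑' g, (convPow μ n g).toReal * Real.log (interpolationWeight S H μ s₁ n g)) := by
    rw [hlog.tsum_eq]
    ring
  rw [hlim, ← ((continuous_coe_real_ereal.tendsto _).comp lower).liminf_eq]
  refine liminf_le_liminf ?_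
  filter_upwards [Ioc_mem_nhdsGT (show (1 : ℝ) < min 2 (1 + η) by simp [hη])] with q ⟨hq, hqη⟩
  have hmomq : HasFiniteMoment S (convPow μ n) (2 * s₁ * (q - 1)) := by
    refine hmom.mono (le_of_le_of_eq ?_ hηβ)
    gcongr
    linarith [min_le_right 2 (1 + η)]
  exact EReal.coe_le_coe ((hRD.le_spectralRateSeq_of_moment hq (hqη.trans (min_le_left _ _))
    hmomq).trans (spectralRateSeq_le_spectralRate H μ hq hn))

end LowerBound

/-! ### Asymptotic entropy -/

section AsymptoticEntropy

variable {G : Type*} [Group G] (H : Subgroup G) (μ : PMF G)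

theorem lowerRenyiRate_le_upperRenyiRate (α : ℝ) : lowerRenyiRate H μ α ≤ upperRenyiRate H μ α :=
  liminf_le_limsup

theorem lowerRenyiRate_le_lowerEntropy {α : ℝ} (hα : 1 < α) :
    lowerRenyiRate H μ α ≤ lowerEntropy H μ :=
  liminf_le_liminf (Eventually.of_forall (renyiSeq_le_shannonSeq H μ hα))

theorem upperRenyiRate_le_upperEntropy {α : ℝ} (hα : 1 < α) :
    upperRenyiRate H μ α ≤ upperEntropy H μ :=
  limsup_le_limsup (Eventually.of_forall (renyiSeq_le_shannonSeq H μ hα))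

theorem spectralRate_le_lowerEntropy {q : ℝ} (hq : 1 < q) :
    (spectralRate H μ q : EReal) ≤ lowerEntropy H μ :=
  (spectralRate_le_lowerRenyiRate H μ hq).trans (lowerRenyiRate_le_lowerEntropy H μ hq)

theorem limsup_spectralRate_le_lowerEntropy :
    limsup (fun q => (spectralRate H μ q : EReal)) (𝓝[>] 1) ≤ lowerEntropy H μ :=
  limsup_le_of_le (h := eventually_mem_nhdsWithin.mono fun _ hq =>
    spectralRate_le_lowerEntropy H μ hq)

variable {μ}

theorem exists_coe_eq_lowerEntropy (hent : shannonEntropy μ ≠ ∞) :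
    ∃ h : ℝ, (h : EReal) = lowerEntropy H μ := by
  have upper : lowerEntropy H μ ≤ ((shannonEntropy μ).toReal : EReal) := by
    refine liminf_le_of_le (h := fun b hb => ?_)
    obtain ⟨n, hn⟩ := hb.exists
    rw [shannonSeq_eq_coe H hent] at hn
    exact hn.trans (EReal.coe_le_coe (toReal_shannonEntropy_walkLaw_div_le H hent n))
  refine ⟨(lowerEntropy H μ).toReal, EReal.coe_toReal ?_ ?_⟩
  · exact ne_top_of_le_ne_top (EReal.coe_ne_top _) upper
  · exact ne_bot_of_le_ne_bot (EReal.coe_ne_bot _) (spectralRate_le_lowerEntropy H μ one_lt_two)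

variable {H} {S : Finset G} {C s₁ : ℝ} (hS : ∀ s ∈ S, s⁻¹ ∈ S)
  (hgen : Subgroup.closure (S : Set G) = ⊤) (hRD : PairRapidDecay S H C s₁)
include hS hgen hRD

theorem PairRapidDecay.upperEntropy_le_liminf_spectralRate (hent : shannonEntropy μ ≠ ∞) {β : ℝ}
    (hβ : 0 < β) (hmom : HasFiniteMoment S μ β) :
    upperEntropy H μ ≤ liminf (fun q => (spectralRate H μ q : EReal)) (𝓝[>] 1) := by
  have hs := hRD.2.1
  let γ := min β 1
  have hγ : 0 < γ := lt_min hβ one_pos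
  have hmomγ : HasFiniteMoment S μ γ := hmom.mono (min_le_left _ _)
  let M := (∑' g, μ g * lengthWeight S γ g).toReal
  let e : ℕ → ℝ := fun n =>
    2 * Real.log C / n + 2 * s₁ * γ⁻¹ * (Real.log (1 + n * M) / n)
  have he : Tendsto e atTop (𝓝 0) := by
    simpa using (tendsto_const_div_atTop_nhds_zero_nat (2 * Real.log C)).add
      ((tendsto_log_one_add_mul_div ENNReal.toReal_nonneg).const_mul (2 * s₁ * γ⁻¹))
  let L := liminf (fun q => (spectralRate H μ q : EReal)) (𝓝[>] 1)
  have hle : ∀ n ≠ 0, shannonSeq H μ n ≤ L + e n := fun n hn => by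
    have hlower := hRD.le_liminf_spectralRate hn (shannonEntropy_walkLaw_ne_top H hent n) hγ
      (hmomγ.convPow hS hgen hγ.le n)
    have herr : (2 * Real.log C + 2 * s₁ * meanLogLength S μ n) / n ≤ e n := calc
      _ ≤ (2 * Real.log C + 2 * s₁ * (γ⁻¹ * Real.log (1 + n * M))) / n := by
        gcongr
        exact meanLogLength_le hS hgen hγ (min_le_right _ _) hmomγ n
      _ = e n := by ring
    calc shannonSeq H μ n
        ≤ ((((shannonEntropy (walkLaw H μ n)).toReal -
            (2 * Real.log C + 2 * s₁ * meanLogLength S μ n)) / n + e n : ℝ) : EReal) := by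
          rw [shannonSeq_eq_coe H hent, EReal.coe_le_coe_iff, sub_div]
          linarith
      _ ≤ L + e n := by
          rw [EReal.coe_add]
          gcongr
  have hlim : Tendsto (fun n => L + (e n : EReal)) atTop (𝓝 L) := by
    have hadd := (EReal.continuousAt_add (p := (L, 0)) (by simp) (by simp)).tendsto.comp
      (tendsto_const_nhds.prodMk_nhds ((continuous_coe_real_ereal.tendsto 0).comp he))
    simpa [Function.comp_def] using hadd
  exact (limsup_le_limsup ((eventually_ne_atTop 0).mono hle)).trans_eq hlim.limsup_eq

theorem PairRapidDecay.exists_entropy (hent : shannonEntropy μ ≠ ∞) {β : ℝ}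
    (hβ : 0 < β) (hmom : HasFiniteMoment S μ β) :
    ∃ h : ℝ, Tendsto (shannonSeq H μ) atTop (𝓝 (h : EReal)) ∧
      Tendsto (spectralRate H μ) (𝓝[>] 1) (𝓝 h) := by
  obtain ⟨h, hh⟩ := exists_coe_eq_lowerEntropy H hent
  have upper := hRD.upperEntropy_le_liminf_spectralRate hS hgen hent hβ hmom
  have lower := limsup_spectralRate_le_lowerEntropy H μ
  refine ⟨h, ?_, EReal.tendsto_coe.1 ?_⟩ <;> rw [hh]
  · exact tendsto_of_le_liminf_of_limsup_le le_rfl (upper.trans (le_trans liminf_le_limsup lower))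
  · exact tendsto_of_le_liminf_of_limsup_le (le_trans liminf_le_limsup upper) lower

end AsymptoticEntropy

section RenyiRate

variable {G : Type*} [Group G] {H : Subgroup G} {μ : PMF G} {h : ℝ}
  (hshannon : Tendsto (shannonSeq H μ) atTop (𝓝 (h : EReal)))
  (hrate : Tendsto (spectralRate H μ) (𝓝[>] 1) (𝓝 h))
include hshannon hrate

theorem tendsto_of_spectralRate_le_of_le_upperEntropy {φ : ℝ → EReal}
    (hlower : ∀ α, 1 < α → (spectralRate H μ α : EReal) ≤ φ α)
    (hupper : ∀ α, 1 < α → φ α ≤ upperEntropy H μ) : Tendsto φ (𝓝[>] 1) (𝓝 (h : EReal)) :=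
  tendsto_of_tendsto_of_tendsto_of_le_of_le'
    ((continuous_coe_real_ereal.tendsto h).comp hrate) tendsto_const_nhds
    (eventually_mem_nhdsWithin.mono hlower)
    (eventually_mem_nhdsWithin.mono fun α hα => hshannon.limsup_eq ▸ hupper α hα)

theorem tendsto_lowerRenyiRate : Tendsto (lowerRenyiRate H μ) (𝓝[>] 1) (𝓝 (h : EReal)) :=
  tendsto_of_spectralRate_le_of_le_upperEntropy hshannon hrate
    (fun _ => spectralRate_le_lowerRenyiRate H μ) fun α hα =>
      (lowerRenyiRate_le_upperRenyiRate H μ α).trans (upperRenyiRate_le_upperEntropy H μ hα)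

theorem tendsto_upperRenyiRate : Tendsto (upperRenyiRate H μ) (𝓝[>] 1) (𝓝 (h : EReal)) :=
  tendsto_of_spectralRate_le_of_le_upperEntropy hshannon hrate
    (fun α hα => (spectralRate_le_lowerRenyiRate H μ hα).trans
      (lowerRenyiRate_le_upperRenyiRate H μ α)) fun _ => upperRenyiRate_le_upperEntropy H μ

end RenyiRate

/-! ### Finitely supported measures -/

section FiniteSupport

variable {G : Type*} [Group G] {S : Finset G} {H : Subgroup G} {C s₁ : ℝ} {μ : PMF G}

theorem exists_wordLength_le_of_finite (hS : ∀ s ∈ S, s⁻¹ ∈ S)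
    (hgen : Subgroup.closure (S : Set G) = ⊤) (hfin : μ.support.Finite) :
    ∃ L : ℕ, ∀ (n : ℕ) (g : G), convPow μ n g ≠ 0 → wordLength S g ≤ n * L := by
  refine ⟨hfin.toFinset.sup (wordLength S), fun n => ?_⟩
  induction n with
  | zero =>
    intro g hg
    obtain rfl : g = 1 := by simpa [convPow, PMF.pure_apply] using hg
    simp [wordLength_one]
  | succ n ih =>
    intro g hg
    rw [coe_convPow_succ, conv, Ne, ENNReal.tsum_eq_zero, not_forall] at hg
    obtain ⟨s, hs⟩ := hg
    have length_s : wordLength S s ≤ hfin.toFinset.sup (wordLength S) :=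
      Finset.le_sup (by simpa using left_ne_zero_of_mul hs)
    have length_g := wordLength_mul_le hS hgen s (s⁻¹ * g)
    rw [mul_inv_cancel_left] at length_g
    linarith [ih _ (right_ne_zero_of_mul hs)]

theorem tsum_mul_lengthWeight_rpow_mul_le {n : ℕ} {s b q : ℝ} (hs : 0 ≤ s) (hq : 1 ≤ q)
    (hb : ∀ g : G, convPow μ n g ≠ 0 → 1 + (wordLength S g : ℝ) ≤ b) :
    ∑' g : G, convPow μ n g * lengthWeight S s g ^ (2 * (q - 1)) * walkLaw H μ n g ^ (q - 1) ≤
      ENNReal.ofReal (b ^ s) ^ (2 * (q - 1)) * ∑' x, walkLaw H μ n x ^ q := by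
  rw [coe_walkLaw, ← tsum_mul_fiberSum_rpow H hq, ← ENNReal.tsum_mul_left]
  refine ENNReal.tsum_le_tsum fun g => ?_
  rw [mul_comm (convPow μ n g), mul_assoc]
  rcases eq_or_ne (convPow μ n g) 0 with hg | hg
  · simp [hg]
  have : 0 ≤ q - 1 := sub_nonneg.2 hq
  rw [lengthWeight]
  gcongr
  exact hb g hg

theorem PairRapidDecay.renyiSeq_le_of_wordLength_le (hRD : PairRapidDecay S H C s₁) {q : ℝ}
    (hq : 1 < q) (hq2 : q ≤ 2) {n : ℕ} {b : ℝ} (hb0 : 0 < b)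
    (hb : ∀ g : G, convPow μ n g ≠ 0 → 1 + (wordLength S g : ℝ) ≤ b) :
    renyiSeq H μ q n ≤
      ((spectralRateSeq H μ q n + (2 * Real.log C / n + 2 * s₁ * (Real.log b / n)) : ℝ) :
        EReal) := by
  have hq0 : 0 < q - 1 := sub_pos.2 hq
  let Z := (∑' x, walkLaw H μ n x ^ q).toReal
  have hZ : 0 < Z :=
    ENNReal.toReal_pos (tsum_rpow_ne_zero _ (by linarith)) (tsum_rpow_ne_top _ hq.le)
  have hlower := hRD.le_spectralRateSeq μ hq hq2 n (K := (b ^ s₁) ^ (2 * (q - 1)) * Z)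
    (by positivity) (by
      rw [ENNReal.ofReal_mul (by positivity), ENNReal.ofReal_toReal (tsum_rpow_ne_top _ hq.le),
        ← ENNReal.ofReal_rpow_of_pos (by positivity)]
      exact tsum_mul_lengthWeight_rpow_mul_le hRD.2.1.le hq.le hb)
  rw [Real.log_mul (by positivity) hZ.ne', Real.log_rpow (by positivity), Real.log_rpow hb0,
    add_div, mul_assoc 2, mul_comm (q - 1), ← mul_assoc, mul_div_cancel_right₀ _ hq0.ne'] at hlower
  rw [renyiSeq_eq_coe H μ hq.le, EReal.coe_le_coe_iff, ← neg_sub q 1, one_div, inv_neg]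
  refine le_of_eq_of_le ?_ (add_le_add_left hlower _)
  ring

theorem PairRapidDecay.tendsto_renyiSeq_of_finite (hS : ∀ s ∈ S, s⁻¹ ∈ S)
    (hgen : Subgroup.closure (S : Set G) = ⊤) (hRD : PairRapidDecay S H C s₁)
    (hfin : μ.support.Finite) {α : ℝ} (hα : 1 < α) (hα2 : α ≤ 2) :
    Tendsto (renyiSeq H μ α) atTop (𝓝 (spectralRate H μ α : EReal)) := by
  obtain ⟨L, hL⟩ := exists_wordLength_le_of_finite hS hgen hfin
  have lower := tendsto_spectralRateSeq H μ hα.le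
  have error : Tendsto (fun n : ℕ => 2 * Real.log C / n + 2 * s₁ * (Real.log (1 + n * L) / n))
      atTop (𝓝 0) := by
    simpa using (tendsto_const_div_atTop_nhds_zero_nat (2 * Real.log C)).add
      ((tendsto_log_one_add_mul_div (Nat.cast_nonneg L)).const_mul (2 * s₁))
  have upper := lower.add error
  rw [add_zero] at upper
  refine tendsto_of_tendsto_of_tendsto_of_le_of_le
    ((continuous_coe_real_ereal.tendsto _).comp lower)
    ((continuous_coe_real_ereal.tendsto _).comp upper)
    (spectralRateSeq_le_renyiSeq H μ hα) fun n =>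
      hRD.renyiSeq_le_of_wordLength_le hα hα2 (by positivity) fun g hg => ?_
  gcongr
  exact_mod_cast hL n g hg

end FiniteSupport

end HomogeneousEntropy

end

open HomogeneousEntropy in
theorem theoremA_general {G : Type*} [Group G] (S : Finset G)
    (hSsymm : ∀ s ∈ S, s⁻¹ ∈ S) (hSgen : Subgroup.closure (S : Set G) = ⊤)
    (H : Subgroup G) (C s₁ : ℝ) (hRD : PairRapidDecay S H C s₁)
    (μ : PMF G) (hent : shannonEntropy μ < ∞)
    (β : ℝ) (hβ : 0 < β) (hmom : HasFiniteMoment S μ β) :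
    Tendsto (spectralFun H μ) atTop (𝓝 (spectralEntropy H μ)) ∧
    lowerEntropy H μ = spectralEntropy H μ ∧
    upperEntropy H μ = spectralEntropy H μ ∧
    ∃ h : ℝ,
      (h : EReal) = spectralEntropy H μ ∧
      Tendsto (shannonSeq H μ) atTop (𝓝 (h : EReal)) ∧
      Tendsto (lowerRenyiRate H μ) (𝓝[>] 1) (𝓝 (h : EReal)) ∧
      Tendsto (upperRenyiRate H μ) (𝓝[>] 1) (𝓝 (h : EReal)) ∧
      (μ.support.Finite →
        ∃ hα : ℝ → ℝ,
          (∀ α : ℝ, 1 < α → α ≤ 2 →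
            Tendsto (renyiSeq H μ α) atTop (𝓝 (hα α : EReal)) ∧
            (hα α : EReal) = ((α / (1 - α) : ℝ) : EReal) * ENNReal.log (specRad H μ α)) ∧
          Tendsto hα (𝓝[>] 1) (𝓝 h)) := by
  obtain ⟨h, hshannon, hrate⟩ := hRD.exists_entropy hSsymm hSgen hent.ne hβ hmom
  have hspec := tendsto_spectralFun H μ hrate
  have hc : spectralEntropy H μ = h := hspec.limUnder_eq
  rw [hc]
  refine ⟨hspec, hshannon.liminf_eq, hshannon.limsup_eq, h, rfl, hshannon,
    tendsto_lowerRenyiRate hshannon hrate, tendsto_upperRenyiRate hshannon hrate,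
    fun hfin => ⟨spectralRate H μ, fun α hα hα2 => ⟨?_, coe_spectralRate H μ hα.le⟩, hrate⟩⟩
  exact hRD.tendsto_renyiSeq_of_finite hSsymm hSgen hfin hα hα2

open HomogeneousEntropy in
theorem theoremA {G : Type*} [Group G] (S : Finset G)
    (hSsymm : ∀ s ∈ S, s⁻¹ ∈ S) (hSgen : Subgroup.closure (S : Set G) = ⊤)
    (H : Subgroup G) (C s₁ : ℝ) (hRD : PairRapidDecay S H C s₁)
    (μ : PMF G) (hent : shannonEntropy μ < ∞)
    (β : ℝ) (hβ : 2 * s₁ ≤ β) (hmom : HasFiniteMoment S μ β) :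
    -- the limit defining `c(G,H;μ)` exists
    Tendsto (spectralFun H μ) atTop (𝓝 (spectralEntropy H μ)) ∧
    lowerEntropy H μ = spectralEntropy H μ ∧
    upperEntropy H μ = spectralEntropy H μ ∧
    -- the asymptotic Shannon entropy `h` exists (as a finite limit)
    ∃ h : ℝ,
      (h : EReal) = spectralEntropy H μ ∧
      Tendsto (shannonSeq H μ) atTop (𝓝 (h : EReal)) ∧
      Tendsto (lowerRenyiRate H μ) (𝓝[>] 1) (𝓝 (h : EReal)) ∧
      Tendsto (upperRenyiRate H μ) (𝓝[>] 1) (𝓝 (h : EReal)) ∧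
      (μ.support.Finite →
        ∃ hα : ℝ → ℝ,
          (∀ α : ℝ, 1 < α → α ≤ 2 →
            Tendsto (renyiSeq H μ α) atTop (𝓝 (hα α : EReal)) ∧
            (hα α : EReal) = ((α / (1 - α) : ℝ) : EReal) * ENNReal.log (specRad H μ α)) ∧
          Tendsto hα (𝓝[>] 1) (𝓝 h)) :=
  theoremA_general S hSsymm hSgen H C s₁ hRD μ hent β (by linarith [hRD.2.1]) hmom
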